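/- **Setting.** Let $\Gamma$ be a set of sites with a metric $d$. At each site $x$ there is a quantum system of finite dimension $d_x$ with $1\le d_x\le N$, where $N$ is independent of $x$. For a finite set $\Lambda\subset\Gamma$ put $\mathfrak A(\Lambda)=\bigotimes_{x\in\Lambda}M_{d_x}(\mathbb C)$; for $\Lambda\subset\Lambda'$ identify $A$ with $A\otimes I$ in $\mathfrak A(\Lambda')$. Let $\mathfrak A$ be the quasi-local algebra, i.e. the norm completion of $\bigcup_\Lambda\mathfrak A(\Lambda)$. An *interaction* is a map $\Phi$ assigning to every finite $\Lambda\subset\Gamma$ a self-adjoint element $\Phi(\Lambda)\in\mathfrak A(\Lambda)$. For $\lambda>0$ put $$\|\Phi\|_\lambda=\sup_{x\in\Gamma}\ \sum_{\Lambda\ni x}|\Lambda|\,\|\Phi(\Lambda)\|\,N^{2|\Lambda|}\,e^{\lambda\operatorname{diam}(\Lambda)}\in[0,\infty],$$ the sum being over finite sets $\Lambda$. Put $H_\Lambda=\sum_{X\subset\Lambda}\Phi(X)$ and $\alpha^\Lambda_t(A)=e^{itH_\Lambda}Ae^{-itH_\Lambda}$. By the *dynamics* of $\Phi$ we mean a strongly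 continuous one-parameter group $t\mapsto\alpha_t$ of $*$-automorphisms of $\mathfrak A$ with $\alpha_t(A)=\lim_\Lambda\alpha_t^\Lambda(A)$ in norm for all $A\in\mathfrak A$, $t\in\mathbb R$ (limit along the net of finite subsets of $\Gamma$) and such that, for every local $A$ (that is, $A\in\mathfrak A(X)$ with $X$ finite), the limit $\delta(A)=\lim_\Lambda i[H_\Lambda,A]$ exists and $\frac{d}{dt}\alpha_t(A)\big|_{t=0}=\delta(A)$. Given the dynamics, for $B\in\mathfrak A$, $x\in\Gamma$, $t\in\mathbb R$ put $$C_B(x,t)=\sup_{0\ne A\in\mathfrak A(\{x\})}\frac{\|[\alpha_t(A),B]\|}{\|A\|}.$$ **Theorem (Lieb–Robinson).** Let $\lambda>0$ and let $\Phi$ be an interaction with $\|\Phi\|_\lambda<\infty$. Then $\Phi$ has one and only one dynamics $\alpha$, and: 1. For all $x\in\Gamma$, $t\in\mathbb R$ and $B\in\mathfrak A$, $$C_B(x,t)\le e^{2|t|\|\Phi\|_\lambda}\,C_B(x,0)+\sum_{y\in\Gamma,\ y\ne x}e^{-\lambda d(x,y)}\left(e^{2|t|\|\Phi\|_\lambda}-1\right)C_B(y,0),$$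 where the right-hand side is read in $[0,\infty]$. 2. In particular the commutator decays exponentially with the distance: if $X\subset\Gamma$ is finite, $B\in\mathfrak A(X)$, $x\in\Gamma\setminus X$ and $t\in\mathbb R$, then $$C_B(x,t)\le 2\,|X|\,\|B\|\,e^{-\lambda d(x,X)}\left(e^{2|t|\|\Phi\|_\lambda}-1\right),$$ where $d(x,X)=\min_{y\in X}d(x,y)$ (for $X=\emptyset$ both sides are $0$). -/

import Mathlib

open scoped ENNReal Topology

noncomputable section

namespace SpinSystem

variable {Γ : Type*} [DecidableEq Γ]

/-! ### The quasi-local algebra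

`d x` is the dimension of the quantum system at the site `x`, whose observables are the
`d x × d x` complex matrices.  A configuration chooses a basis vector at every site. -/

/-- Configurations of the whole system. -/
abbrev Config (d : Γ → ℕ) : Type _ := (x : Γ) → Fin (d x)

/-- Configurations of the sites in the finite set `Λ`. -/
abbrev LocalConfig (d : Γ → ℕ) (Λ : Finset Γ) : Type _ := (x : Λ) → Fin (d x)

/-- The full matrix algebra on `⨂_{x ∈ Λ} ℂ^(d x)`, that is `⨂_{x ∈ Λ} M_{d x}(ℂ)`: the rows and
columns are indexed by the product basis. -/
abbrev LocalMatrix (d : Γ → ℕ) (Λ : Finset Γ) : Type _ :=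
  Matrix (LocalConfig d Λ) (LocalConfig d Λ) ℂ

/-- The Hilbert space `ℓ²` of all configurations.  It only serves to carry one concrete faithful
representation of all the local matrix algebras at once. -/
abbrev ConfigSpace (d : Γ → ℕ) : Type _ := lp (fun _ : Config d => ℂ) 2

variable {d : Γ → ℕ}

/-- The restriction of a configuration to `Λ`. -/
def restr (Λ : Finset Γ) (σ : Config d) : LocalConfig d Λ := fun x => σ x

/-- The configuration `σ` with its part in `Λ` replaced by `τ`. -/
def patch (Λ : Finset Γ) (σ : Config d) (τ : LocalConfig d Λ) : Config d :=
  fun x => if h : x ∈ Λ then τ ⟨x, h⟩ else σ x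

@[simp]
theorem restr_patch (Λ : Finset Γ) (σ : Config d) (τ : LocalConfig d Λ) :
    restr Λ (patch Λ σ τ) = τ := by
  funext x
  simp [restr, patch]

@[simp]
theorem patch_restr (Λ : Finset Γ) (σ : Config d) : patch Λ σ (restr Λ σ) = σ := by
  funext x
  simp [restr, patch]

@[simp]
theorem patch_patch (Λ : Finset Γ) (σ : Config d) (τ ρ : LocalConfig d Λ) :
    patch Λ (patch Λ σ τ) ρ = patch Λ σ ρ := by
  funext x
  by_cases h : x ∈ Λ <;> simp [patch, h]

/-- Exchanging the part in `Λ` of a configuration with a second configuration of `Λ`. -/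
def swapEquiv (d : Γ → ℕ) (Λ : Finset Γ) :
    Config d × LocalConfig d Λ ≃ Config d × LocalConfig d Λ where
  toFun p := (patch Λ p.1 p.2, restr Λ p.1)
  invFun p := (patch Λ p.1 p.2, restr Λ p.1)
  left_inv p := by simp
  right_inv p := by simp

theorem memlp_patch (Λ : Finset Γ) (ψ : ConfigSpace d) (τ : LocalConfig d Λ) :
    Memℓp (fun σ : Config d => (ψ (patch Λ σ τ) : ℂ)) 2 := by
  have hp : (0 : ℝ) < (2 : ℝ≥0∞).toReal := by norm_num
  apply memℓp_gen
  have h1 : Summable fun σ : Config d => ‖ψ σ‖ ^ (2 : ℝ≥0∞).toReal :=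
    (memℓp_gen_iff hp).1 (lp.memℓp ψ)
  have h2 : Summable fun p : Config d × LocalConfig d Λ =>
      ‖ψ p.1‖ ^ (2 : ℝ≥0∞).toReal * (1 : ℝ) :=
    h1.mul_of_nonneg (g := fun _ : LocalConfig d Λ => (1 : ℝ)) (Summable.of_finite)
      (fun σ => by positivity) (fun _ => zero_le_one)
  have h3 := ((swapEquiv d Λ).summable_iff.2 h2).prod_symm.prod_factor τ
  simpa [swapEquiv, Function.comp_def] using h3

theorem memlp_local (Λ : Finset Γ) (a : LocalMatrix d Λ) (ψ : ConfigSpace d) :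
    Memℓp (fun σ : Config d => ∑ τ, a (restr Λ σ) τ * (ψ (patch Λ σ τ) : ℂ)) 2 := by
  have hp : (0 : ℝ) < (2 : ℝ≥0∞).toReal := by norm_num
  refine Memℓp.finsetSum (E := fun _ : Config d => ℂ) Finset.univ
    (f := fun τ σ => a (restr Λ σ) τ * (ψ (patch Λ σ τ) : ℂ)) fun τ _ => ?_
  have h1 := (memℓp_gen_iff hp).1
    ((memlp_patch Λ ψ τ).const_smul ((∑ s, ‖a s τ‖ : ℝ) : ℂ))
  refine memℓp_gen (Summable.of_nonneg_of_le (fun σ => by positivity) (fun σ => ?_) h1)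
  have hC : ‖a (restr Λ σ) τ‖ ≤ ∑ s, ‖a s τ‖ :=
    Finset.single_le_sum (f := fun s => ‖a s τ‖) (fun s _ => norm_nonneg _) (Finset.mem_univ _)
  have hC0 : 0 ≤ ∑ s, ‖a s τ‖ := (norm_nonneg _).trans hC
  gcongr
  simp only [Pi.smul_apply, smul_eq_mul, norm_mul, Complex.norm_real]
  gcongr
  exact hC.trans (le_abs_self _)

/-- The action of a matrix of `Λ` on `ℓ²`: it acts on the part in `Λ` of a configuration and
leaves the other sites alone, so that it is `a ⊗ 1`. -/
def localOpLin (Λ : Finset Γ) (a : LocalMatrix d Λ) : ConfigSpace d →ₗ[ℂ] ConfigSpace d where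
  toFun ψ := ⟨fun σ => ∑ τ, a (restr Λ σ) τ * (ψ (patch Λ σ τ) : ℂ), memlp_local Λ a ψ⟩
  map_add' ψ φ := by
    ext σ
    simp only [lp.coeFn_add, Pi.add_apply, mul_add, Finset.sum_add_distrib]
  map_smul' c ψ := by
    ext σ
    simp [Finset.mul_sum, mul_left_comm]

theorem localOpLin_continuous (Λ : Finset Γ) (a : LocalMatrix d Λ) :
    Continuous (localOpLin Λ a) := by
  apply LinearMap.continuous_of_seq_closed_graph
  intro u ψ φ hu hφ
  have ev : ∀ σ : Config d, Continuous fun χ : ConfigSpace d => (χ σ : ℂ) := fun σ =>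
    (lp.evalCLM ℂ (fun _ : Config d => ℂ) 2 σ).continuous
  ext σ
  have h1 := ((ev σ).tendsto φ).comp hφ
  have h2 : Filter.Tendsto
      (fun n => ∑ τ, a (restr Λ σ) τ * (u n (patch Λ σ τ) : ℂ)) Filter.atTop
      (𝓝 (∑ τ, a (restr Λ σ) τ * (ψ (patch Λ σ τ) : ℂ))) :=
    tendsto_finsetSum _ fun τ _ => (((ev (patch Λ σ τ)).tendsto ψ).comp hu).const_mul _
  exact tendsto_nhds_unique h1 h2

/-- The bounded operator `a ⊗ 1` on `ℓ²`. -/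
def localOp (Λ : Finset Γ) (a : LocalMatrix d Λ) : ConfigSpace d →L[ℂ] ConfigSpace d :=
  ⟨localOpLin Λ a, localOpLin_continuous Λ a⟩

theorem localOp_apply (Λ : Finset Γ) (a : LocalMatrix d Λ) (ψ : ConfigSpace d) (σ : Config d) :
    (localOp Λ a ψ σ : ℂ) = ∑ τ, a (restr Λ σ) τ * (ψ (patch Λ σ τ) : ℂ) := rfl

theorem localOp_star (Λ : Finset Γ) (a : LocalMatrix d Λ) :
    localOp Λ (star a) = star (localOp Λ a) := by
  rw [ContinuousLinearMap.star_eq_adjoint, ContinuousLinearMap.eq_adjoint_iff]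
  intro ψ φ
  have key : ∀ τ : LocalConfig d Λ, ∀ σ : Config d,
      (swapEquiv d Λ (σ, τ)) = (patch Λ σ τ, restr Λ σ) := fun _ _ => rfl
  -- both sides are sums over pairs, exchanged by `swapEquiv`
  let F : Config d × LocalConfig d Λ → ℂ := fun p =>
    a (restr Λ p.1) p.2 * (φ (patch Λ p.1 p.2) : ℂ) * star (ψ p.1 : ℂ)
  have hF : Summable F := by
    have h : ∀ τ : LocalConfig d Λ, Summable fun σ => F (σ, τ) := by
      intro τ
      have m : Memℓp (fun σ : Config d => a (restr Λ σ) τ * (φ (patch Λ σ τ) : ℂ)) 2 := by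
        have := memlp_local Λ (fun s t => if t = τ then a s t else 0) φ
        simpa using this
      simpa [F] using lp.summable_inner (𝕜 := ℂ) ψ (⟨_, m⟩ : ConfigSpace d)
    have h2 : Summable fun p : LocalConfig d Λ × Config d => F (p.2, p.1) := by
      rw [← summable_norm_iff]
      refine (summable_prod_of_nonneg fun _ => norm_nonneg _).2
        ⟨fun τ => (h τ).norm, Summable.of_finite⟩
    exact h2.prod_symm
  have hr : HasSum (fun σ => ∑ τ, F (σ, τ)) (inner ℂ ψ (localOp Λ a φ)) := by
    convert lp.hasSum_inner (𝕜 := ℂ) ψ (localOp Λ a φ) using 2 with σ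
    · rfl
    · simp [F, localOp_apply, Finset.sum_mul]
  have hr' : inner ℂ ψ (localOp Λ a φ) = ∑' p, F p := by
    rw [hF.tsum_prod]
    simp only [tsum_fintype]
    exact hr.tsum_eq.symm
  have hl : HasSum (fun σ => ∑ τ, F (swapEquiv d Λ (σ, τ)))
      (inner ℂ (localOp Λ (star a) ψ) φ) := by
    convert lp.hasSum_inner (𝕜 := ℂ) (localOp Λ (star a) ψ) φ using 2 with σ
    · rfl
    · simp [F, localOp_apply, key, Matrix.star_apply, Finset.mul_sum]
      refine Finset.sum_congr rfl fun τ _ => by ring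
  have hF' : Summable fun p => F (swapEquiv d Λ p) := (swapEquiv d Λ).summable_iff.2 hF
  have hl' : inner ℂ (localOp Λ (star a) ψ) φ = ∑' p, F (swapEquiv d Λ p) := by
    rw [hF'.tsum_prod]
    simp only [tsum_fintype]
    exact hl.tsum_eq.symm
  rw [hl', hr', (swapEquiv d Λ).tsum_eq]

/-- The representation `a ↦ a ⊗ 1` of the matrix algebra of `Λ` as a `*`-homomorphism. -/
def localRep (d : Γ → ℕ) (Λ : Finset Γ) :
    LocalMatrix d Λ →⋆ₐ[ℂ] (ConfigSpace d →L[ℂ] ConfigSpace d) where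
  toFun := localOp Λ
  map_one' := by
    ext ψ σ
    simp [localOp_apply, Matrix.one_apply]
  map_mul' a b := by
    ext ψ σ
    simp only [mul_apply_eq_comp, localOp_apply, Matrix.mul_apply, restr_patch,
      patch_patch, Finset.sum_mul, Finset.mul_sum, mul_assoc]
    exact Finset.sum_comm
  map_zero' := by
    ext ψ σ
    simp [localOp_apply]
  map_add' a b := by
    ext ψ σ
    simp [localOp_apply, add_mul, Finset.sum_add_distrib]
  commutes' c := by
    ext ψ σ
    simp [localOp_apply, Matrix.one_apply, Algebra.algebraMap_eq_smul_one]
  map_star' a := localOp_star Λ a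

theorem localRep_apply (Λ : Finset Γ) (a : LocalMatrix d Λ) (ψ : ConfigSpace d) (σ : Config d) :
    (localRep d Λ a ψ σ : ℂ) = ∑ τ, a (restr Λ σ) τ * (ψ (patch Λ σ τ) : ℂ) := rfl

theorem localRep_injective [∀ x, NeZero (d x)] (Λ : Finset Γ) :
    Function.Injective (localRep d Λ) := by
  intro a b hab
  classical
  ext s t
  let σ₀ : Config d := fun _ => 0
  have h := congrArg (fun T => (T (lp.single 2 (patch Λ σ₀ t) (1 : ℂ)) (patch Λ σ₀ s) : ℂ)) hab
  have e : ∀ τ : LocalConfig d Λ, patch Λ σ₀ τ = patch Λ σ₀ t ↔ τ = t := fun τ =>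
    ⟨fun h => by simpa using congrArg (restr Λ) h, fun h => by rw [h]⟩
  simpa [localRep_apply, lp.single_apply, Pi.single_apply, e] using h

open scoped Matrix.Norms.L2Operator in
/-- The representation is isometric for the `C*`-norm (operator norm) of the matrix algebra. -/
theorem norm_localRep [∀ x, NeZero (d x)] (Λ : Finset Γ) (a : LocalMatrix d Λ) :
    ‖localRep d Λ a‖ = ‖a‖ :=
  NonUnitalStarAlgHom.norm_map (localRep d Λ) (localRep_injective Λ) a

/-- The inclusion `a ↦ a ⊗ 1` of the matrix algebra of `Λ` into that of a larger set `Λ'`. -/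
def extendMatrix {Λ Λ' : Finset Γ} (h : Λ ⊆ Λ') (a : LocalMatrix d Λ) : LocalMatrix d Λ' :=
  fun s t => if ∀ x : Λ', (x : Γ) ∉ Λ → s x = t x
    then a (fun x => s ⟨x, h x.2⟩) (fun x => t ⟨x, h x.2⟩) else 0

/-- The representations are compatible with the inclusions of the net. -/
theorem localRep_extendMatrix {Λ Λ' : Finset Γ} (h : Λ ⊆ Λ') (a : LocalMatrix d Λ) :
    localRep d Λ' (extendMatrix h a) = localRep d Λ a := by
  ext ψ σ
  simp only [localRep_apply, extendMatrix, ite_mul, zero_mul]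
  rw [← Finset.sum_filter]
  refine Finset.sum_bij' (fun t _ => fun x : Λ => t ⟨x, h x.2⟩)
    (fun τ _ => restr Λ' (patch Λ σ τ)) (fun _ _ => Finset.mem_univ _) ?_ ?_ ?_ ?_
  · intro τ _
    simp only [Finset.mem_filter, Finset.mem_univ, true_and]
    intro x hx
    simp [restr, patch, hx]
  · intro t ht
    simp only [Finset.mem_filter, Finset.mem_univ, true_and] at ht
    funext x
    by_cases hx : (x : Γ) ∈ Λ
    · simp [restr, patch, hx]
    · simpa [restr, patch, hx] using ht x hx
  · intro τ _
    funext x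
    simp [restr, patch]
  · intro t ht
    simp only [Finset.mem_filter, Finset.mem_univ, true_and] at ht
    have : patch Λ' σ t = patch Λ σ (fun x : Λ => t ⟨x, h x.2⟩) := by
      funext x
      by_cases hx : x ∈ Λ
      · simp [patch, hx, h hx]
      · by_cases hx' : x ∈ Λ'
        · simpa [patch, hx, hx', restr] using (ht ⟨x, hx'⟩ hx).symm
        · simp [patch, hx, hx']
    rw [this]
    rfl

theorem range_localRep_mono (d : Γ → ℕ) : Monotone fun Λ : Finset Γ => (localRep d Λ).range := by
  rintro Λ Λ' h _ ⟨a, rfl⟩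
  exact ⟨extendMatrix h a, localRep_extendMatrix h a⟩

/-- The quasi-local algebra: the norm completion of the directed union of the local algebras,
realised as the norm closure of the union inside the bounded operators on `ℓ²`. -/
def quasiLocalAlgebra (d : Γ → ℕ) : StarSubalgebra ℂ (ConfigSpace d →L[ℂ] ConfigSpace d) :=
  (⨆ Λ : Finset Γ, (localRep d Λ).range).topologicalClosure

/-- The quasi-local algebra is the closure of the union of the local algebras. -/
theorem coe_quasiLocalAlgebra (d : Γ → ℕ) :
    (quasiLocalAlgebra d : Set (ConfigSpace d →L[ℂ] ConfigSpace d)) =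
      closure (⋃ Λ : Finset Γ, ((localRep d Λ).range : Set _)) := by
  rw [quasiLocalAlgebra, StarSubalgebra.topologicalClosure_coe,
    StarSubalgebra.coe_iSup_of_directed (range_localRep_mono d).directed_le]

/-- The quasi-local algebra as a `C*`-algebra in its own right. -/
abbrev QuasiLocal (d : Γ → ℕ) : Type _ := quasiLocalAlgebra d

instance (d : Γ → ℕ) : CompleteSpace (QuasiLocal d) :=
  (StarSubalgebra.isClosed_topologicalClosure _).completeSpace_coe

/-- The algebra `𝔄(Λ)` of observables localised in the finite set `Λ`, a subalgebra of the
quasi-local algebra. -/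
def localAlgebra (d : Γ → ℕ) (Λ : Finset Γ) : StarSubalgebra ℂ (QuasiLocal d) :=
  (localRep d Λ).range.comap (quasiLocalAlgebra d).subtype

/-! ### Interactions and dynamics -/

/-- An interaction assigns to every finite set of sites a self-adjoint observable localised
there. -/
structure Interaction (d : Γ → ℕ) where
  /-- The interaction term of a finite set of sites. -/
  term : Finset Γ → QuasiLocal d
  term_mem : ∀ Λ, term Λ ∈ localAlgebra d Λ
  isSelfAdjoint_term : ∀ Λ, IsSelfAdjoint (term Λ)

/-- `‖Φ‖_λ = sup_x ∑_{Λ ∋ x} |Λ| ‖Φ(Λ)‖ N^{2|Λ|} e^{λ diam Λ}`, in `[0, ∞]`. -/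
def Interaction.norm [MetricSpace Γ] (Φ : Interaction d) (N : ℕ) (lam : ℝ) : ℝ≥0∞ :=
  ⨆ x : Γ, ∑' Λ : {Λ : Finset Γ // x ∈ Λ},
    (Λ.1.card : ℝ≥0∞) * ‖Φ.term Λ.1‖ₑ * (N : ℝ≥0∞) ^ (2 * Λ.1.card) *
      ENNReal.ofReal (Real.exp (lam * Metric.diam (Λ.1 : Set Γ)))

/-- The local Hamiltonian `H_Λ = ∑_{X ⊆ Λ} Φ(X)`. -/
def Interaction.hamiltonian (Φ : Interaction d) (Λ : Finset Γ) : QuasiLocal d :=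
  ∑ X ∈ Λ.powerset, Φ.term X

/-- The local dynamics `α_t^Λ(A) = e^{itH_Λ} A e^{-itH_Λ}`. -/
def Interaction.localDynamics (Φ : Interaction d) (Λ : Finset Γ) (t : ℝ) (A : QuasiLocal d) :
    QuasiLocal d :=
  NormedSpace.exp ((Complex.I * t) • Φ.hamiltonian Λ) * A *
    NormedSpace.exp (-((Complex.I * t) • Φ.hamiltonian Λ))

/-- `α` is the time evolution of the infinite system with interaction `Φ`: a strongly continuous
one-parameter group of `*`-automorphisms of the quasi-local algebra which is the limit of the
local dynamics as `Λ → Γ` (along the net of finite sets of sites), and whose generator is, on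
local observables, the derivation `δ(A) = lim_Λ i[H_Λ, A]`. -/
structure IsDynamics (Φ : Interaction d) (α : ℝ → QuasiLocal d ≃⋆ₐ[ℂ] QuasiLocal d) : Prop where
  map_add : ∀ s t A, α (s + t) A = α s (α t A)
  continuous : ∀ A, Continuous fun t => α t A
  tendsto_localDynamics : ∀ t A,
    Filter.Tendsto (fun Λ => Φ.localDynamics Λ t A) Filter.atTop (𝓝 (α t A))
  hasDerivAt_zero : ∀ X, ∀ A ∈ localAlgebra d X, ∃ D : QuasiLocal d,
    Filter.Tendsto (fun Λ => Complex.I • (Φ.hamiltonian Λ * A - A * Φ.hamiltonian Λ))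
      Filter.atTop (𝓝 D) ∧
    HasDerivAt (fun t => α t A) D 0

/-- `C_B(x, t) = sup_{A ∈ 𝔄({x})} ‖[α_t(A), B]‖ / ‖A‖`, with values in `[0, ∞]`.  The term
`A = 0` contributes `0 / 0 = 0`. -/
def commBound (α : ℝ → QuasiLocal d ≃⋆ₐ[ℂ] QuasiLocal d) (B : QuasiLocal d) (x : Γ) (t : ℝ) :
    ℝ≥0∞ :=
  ⨆ A ∈ localAlgebra d {x}, ‖α t A * B - B * α t A‖ₑ / ‖A‖ₑ

end SpinSystem

end

/-!
The dynamics are controlled by one estimate for finite volume. Let `H` be a finite sum of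
interaction terms, let `A` be an observable at the site `x`, and let `K` be the sum of those terms
of `H` that do not contain `x`. The evolution by `K` fixes `A`, so that `‖[α_t(A), B]‖` is the norm
of the commutator of `A` with `e^{itK} α_{-t}(B) e^{-itK}`, and the time derivative of the latter
only involves `H - K`, the sum of the terms `Φ(Z)` with `Z ∋ x` (`norm_lie_conjExp_le`). Expanding
`Φ(Z)` in products of one-site matrix units (`enorm_lie_le_of_mem_local`) bounds the commutator
with `Φ(Z)` by `‖Φ(Z)‖ N^{2|Z|}` times the sum of the commutator bounds at the sites of `Z`.
This gives a linear integral inequality for the functions `C_B(·, t)`, whose iteration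
yields `C_B(·, t) ≤ exp(2|t|T) C_B(·, 0)`, where `T` is the operator `hop`
(`LatticeSystem.enorm_lie_conjExp_le_hopExp`); the bound does not depend on the volume. Since a
chain of sets from `x` to `y` has total diameter at least `d(x, y)`, the `(x, y)` entry of `T^k` is
at most `‖Φ‖_λ^k e^{-λ d(x, y)}` (`hop_iterate_single_le`), and summing over `k` produces the
Lieb-Robinson bound (`hopExp_le`), which passes to the infinite volume.

For the existence of the dynamics no decay in space is needed, since `∑_y e^{-λ d(x, y)}` may well
be infinite. What matters is that the rows of `T` sum to at most `‖Φ‖_λ`: it makes the commutators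
of the interaction terms with the evolution of a local observable summable, uniformly in the volume
(`LatticeSystem.exists_summable_bound_lie`). By comparison of two volumes
(`norm_conjExp_sub_conjExp_le`) the local dynamics are then a Cauchy net on local observables, hence
on all observables, as they are isometric. The same summability gives the limit of the
derivations `i[H_Λ, ·]` and an estimate for small times that is uniform in the volume, from which
the strong continuity and the generator of the limit are obtained. Uniqueness is clear, because the
dynamics are a limit of the local dynamics.
-/

noncomputable section

namespace SpinSystem

/-! ### Inner time evolutions in a `C*`-algebra -/

/-- A function whose derivative at `s` is bounded by the derivative at `|s|` of a real function `p`
is itself bounded by `p |t|`, on both sides of the origin. -/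
theorem norm_le_of_norm_deriv_le_abs {E : Type*} [NormedAddCommGroup E] [NormedSpace ℝ E]
    {f f' : ℝ → E} {p p' : ℝ → ℝ} (hf : ∀ s, HasDerivAt f (f' s) s)
    (hp : ∀ s, HasDerivAt p (p' s) s) (h0 : ‖f 0‖ ≤ p 0) (t : ℝ)
    (hb : ∀ s, |s| ≤ |t| → ‖f' s‖ ≤ p' |s|) : ‖f t‖ ≤ p |t| := by
  -- for a sign `c`, the mean value inequality is applied to `s ↦ f (c * s)` on `[0, |t|]`
  have key : ∀ c : ℝ, |c| = 1 → ‖f (c * |t|)‖ ≤ p |t| := by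
    intro c hc
    have hg : ∀ s, HasDerivAt (fun s => f (c * s)) (c • f' (c * s)) s := fun s => by
      have h := (hf (c * s)).scomp s ((hasDerivAt_id s).const_mul c)
      rwa [mul_one] at h
    refine image_norm_le_of_norm_deriv_right_le_deriv_boundary (a := 0) (b := |t|)
      (f := fun s => f (c * s)) (f' := fun s => c • f' (c * s))
      (fun s _ => (hg s).continuousAt.continuousWithinAt)
      (fun s _ => (hg s).hasDerivWithinAt) (by simpa using h0) hp (fun s hs => ?_)
      ⟨abs_nonneg t, le_rfl⟩
    have hs' : |c * s| = s := by rw [abs_mul, hc, one_mul, abs_of_nonneg hs.1]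
    have := hb (c * s) (by rw [hs']; exact hs.2.le)
    rwa [hs', ← one_mul ‖f' _‖, ← hc, ← Real.norm_eq_abs, ← norm_smul] at this
  rcases le_total 0 t with ht | ht
  · simpa [abs_of_nonneg ht] using key 1 (by simp)
  · simpa [abs_of_nonpos ht] using key (-1) (by simp)

section CStar

variable {𝔄 : Type*} [NormedRing 𝔄]

theorem norm_lie_le (A B : 𝔄) : ‖⁅A, B⁆‖ ≤ 2 * ‖A‖ * ‖B‖ := by
  rw [Ring.lie_def]
  calc ‖A * B - B * A‖ ≤ ‖A * B‖ + ‖B * A‖ := norm_sub_le _ _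
    _ ≤ ‖A‖ * ‖B‖ + ‖B‖ * ‖A‖ := add_le_add (norm_mul_le _ _) (norm_mul_le _ _)
    _ = 2 * ‖A‖ * ‖B‖ := by ring

theorem norm_lie_comm (A B : 𝔄) : ‖⁅A, B⁆‖ = ‖⁅B, A⁆‖ := by
  rw [Ring.lie_def, Ring.lie_def, norm_sub_rev]

theorem enorm_lie_comm (A B : 𝔄) : ‖⁅A, B⁆‖ₑ = ‖⁅B, A⁆‖ₑ := by
  rw [← ofReal_norm, norm_lie_comm, ofReal_norm]

theorem enorm_lie_le (A B : 𝔄) : ‖⁅A, B⁆‖ₑ ≤ 2 * ‖A‖ₑ * ‖B‖ₑ := by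
  rw [← ofReal_norm, ← ofReal_norm, ← ofReal_norm, ← ENNReal.ofReal_ofNat 2,
    ← ENNReal.ofReal_mul (by norm_num), ← ENNReal.ofReal_mul (by positivity)]
  exact ENNReal.ofReal_le_ofReal (norm_lie_le A B)

theorem enorm_lie_of_commute {A B : 𝔄} (h : Commute A B) : ‖⁅A, B⁆‖ₑ = 0 := by
  rw [Ring.lie_def, h.eq, sub_self, enorm_zero]

theorem enorm_le_mul_of_div_le {A X : 𝔄} {C : ℝ≥0∞} (h0 : A = 0 → X = 0)
    (h : ‖X‖ₑ / ‖A‖ₑ ≤ C) : ‖X‖ₑ ≤ ‖A‖ₑ * C := by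
  by_cases hA : A = 0
  · rw [h0 hA, enorm_zero]
    exact zero_le
  · rwa [ENNReal.div_le_iff (enorm_ne_zero.2 hA) enorm_ne_top, mul_comm] at h

/-- The Leibniz rule for commutators, in norm. -/
theorem enorm_mul_lie_le (P Q B : 𝔄) :
    ‖⁅P * Q, B⁆‖ₑ ≤ ‖⁅P, B⁆‖ₑ * ‖Q‖ₑ + ‖P‖ₑ * ‖⁅Q, B⁆‖ₑ := by
  have hmul : ∀ X Y : 𝔄, ‖X * Y‖ₑ ≤ ‖X‖ₑ * ‖Y‖ₑ := fun X Y => by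
    simp only [← ofReal_norm, ← ENNReal.ofReal_mul (norm_nonneg X)]
    exact ENNReal.ofReal_le_ofReal (norm_mul_le X Y)
  have e : ⁅P * Q, B⁆ = ⁅P, B⁆ * Q + P * ⁅Q, B⁆ := by
    simp only [Ring.lie_def, mul_sub, sub_mul, mul_assoc]
    abel
  rw [e]
  exact (enorm_add_le _ _).trans (add_le_add (hmul _ _) (hmul _ _))

theorem sum_lie_eq {ι : Type*} (s : Finset ι) (E : ι → 𝔄) (B : 𝔄) :
    ⁅∑ i ∈ s, E i, B⁆ = ∑ i ∈ s, ⁅E i, B⁆ := by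
  simp only [Ring.lie_def, Finset.sum_mul, Finset.mul_sum, Finset.sum_sub_distrib]

theorem enorm_sum_lie_le {ι : Type*} (s : Finset ι) (E : ι → 𝔄) (B : 𝔄) :
    ‖⁅∑ i ∈ s, E i, B⁆‖ₑ ≤ ∑ i ∈ s, ‖⁅E i, B⁆‖ₑ := by
  rw [sum_lie_eq]
  exact enorm_sum_le _ _

variable [NormedAlgebra ℂ 𝔄]

theorem enorm_smul_lie (c : ℂ) (A B : 𝔄) : ‖⁅c • A, B⁆‖ₑ = ‖c‖ₑ * ‖⁅A, B⁆‖ₑ := by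
  rw [← enorm_smul, Ring.lie_def, Ring.lie_def, smul_mul_assoc, mul_smul_comm, smul_sub]

/-- The inner evolution `e^{itH} A e^{-itH}`. -/
def conjExp (H : 𝔄) (t : ℝ) (A : 𝔄) : 𝔄 :=
  NormedSpace.exp ((Complex.I * t) • H) * A * NormedSpace.exp (-((Complex.I * t) • H))

theorem conjExp_add_right (H : 𝔄) (t : ℝ) (A B : 𝔄) :
    conjExp H t (A + B) = conjExp H t A + conjExp H t B := by
  simp [conjExp, mul_add, add_mul]

theorem conjExp_sub_right (H : 𝔄) (t : ℝ) (A B : 𝔄) :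
    conjExp H t (A - B) = conjExp H t A - conjExp H t B := by
  simp [conjExp, mul_sub, sub_mul]

theorem conjExp_smul (H : 𝔄) (t : ℝ) (c : ℂ) (A : 𝔄) :
    conjExp H t (c • A) = c • conjExp H t A := by
  simp [conjExp]

theorem conjExp_zero_time (H A : 𝔄) : conjExp H 0 A = A := by
  simp [conjExp]

theorem star_exp_smul [StarRing 𝔄] [CStarRing 𝔄] [StarModule ℂ 𝔄] {H : 𝔄}
    (hH : IsSelfAdjoint H) (t : ℝ) :
    star (NormedSpace.exp ((Complex.I * t) • H)) =
      NormedSpace.exp (-((Complex.I * t) • H)) := by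
  rw [NormedSpace.star_exp, star_smul, hH.star_eq]
  simp

theorem star_conjExp [StarRing 𝔄] [CStarRing 𝔄] [StarModule ℂ 𝔄] {H : 𝔄}
    (hH : IsSelfAdjoint H) (t : ℝ) (A : 𝔄) :
    star (conjExp H t A) = conjExp H t (star A) := by
  simp only [conjExp, ← star_exp_smul hH, star_mul, star_star, mul_assoc]

variable [CompleteSpace 𝔄]

theorem exp_mul_exp_smul (H : 𝔄) (s t : ℝ) :
    NormedSpace.exp ((Complex.I * s) • H) * NormedSpace.exp ((Complex.I * t) • H) =
      NormedSpace.exp ((Complex.I * (s + t : ℝ)) • H) := by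
  let : NormedAlgebra ℚ 𝔄 := NormedAlgebra.restrictScalars ℚ ℂ 𝔄
  rw [← NormedSpace.exp_add_of_commute
    (((Commute.refl H).smul_left _).smul_right _), ← add_smul]
  push_cast
  rw [mul_add]

theorem exp_neg_mul_exp (H : 𝔄) (t : ℝ) :
    NormedSpace.exp (-((Complex.I * t) • H)) * NormedSpace.exp ((Complex.I * t) • H) = 1 := by
  have := exp_mul_exp_smul H (-t) t
  simpa using this

theorem conjExp_conjExp (H : 𝔄) (s t : ℝ) (A : 𝔄) :
    conjExp H s (conjExp H t A) = conjExp H (s + t) A := by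
  have h1 := exp_mul_exp_smul H s t
  have h2 := exp_mul_exp_smul H (-t) (-s)
  have e : ∀ r : ℝ, -((Complex.I * r) • H) = (Complex.I * (-r : ℝ)) • H := fun r => by
    simp
  simp only [conjExp, e]
  rw [show -(s + t) = -t + -s by ring, ← h1, ← h2]
  simp only [mul_assoc]

theorem conjExp_neg_conjExp (H : 𝔄) (t : ℝ) (A : 𝔄) : conjExp H (-t) (conjExp H t A) = A := by
  rw [conjExp_conjExp, neg_add_cancel, conjExp_zero_time]

theorem conjExp_conjExp_neg (H : 𝔄) (t : ℝ) (A : 𝔄) : conjExp H t (conjExp H (-t) A) = A := by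
  rw [conjExp_conjExp, add_neg_cancel, conjExp_zero_time]

theorem conjExp_mul (H : 𝔄) (t : ℝ) (A B : 𝔄) :
    conjExp H t (A * B) = conjExp H t A * conjExp H t B := by
  have h := exp_neg_mul_exp H t
  simp only [conjExp]
  simp only [mul_assoc]
  rw [← mul_assoc (NormedSpace.exp (-((Complex.I * t) • H))) (NormedSpace.exp _), h, one_mul]

theorem conjExp_lie (H : 𝔄) (t : ℝ) (A B : 𝔄) :
    conjExp H t ⁅A, B⁆ = ⁅conjExp H t A, conjExp H t B⁆ := by
  simp only [Ring.lie_def, conjExp_sub_right, conjExp_mul]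

theorem conjExp_eq_self_of_commute {H A : 𝔄} (h : Commute H A) (t : ℝ) : conjExp H t A = A := by
  have h1 : Commute (NormedSpace.exp (-((Complex.I * t) • H))) A :=
    ((h.smul_left _).neg_left).exp_left
  rw [conjExp, mul_assoc, ← h1.eq, ← mul_assoc]
  have := exp_neg_mul_exp H (-t)
  simp only [Complex.ofReal_neg, mul_neg, neg_smul, neg_neg] at this
  rw [this, one_mul]

/-- Time derivative of the evolution of a moving observable. -/
theorem hasDerivAt_conjExp_comp (H : 𝔄) {f : ℝ → 𝔄} {f' : 𝔄} {t : ℝ} (hf : HasDerivAt f f' t) :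
    HasDerivAt (fun s => conjExp H s (f s)) (conjExp H t (Complex.I • ⁅H, f t⁆ + f')) t := by
  have e : ∀ s : ℝ, (Complex.I * s) • H = s • (Complex.I • H) := fun s => by
    rw [mul_comm, mul_smul, Complex.coe_smul]
  have h1 := hasDerivAt_exp_smul_const (𝕂 := ℝ) (Complex.I • H) t
  have h2 := hasDerivAt_exp_smul_const' (𝕂 := ℝ) (-(Complex.I • H)) t
  have h3 := (h1.mul hf).mul h2
  have e' : ∀ s : ℝ, -(s • (Complex.I • H)) = s • -(Complex.I • H) := fun s => (smul_neg _ _).symm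
  simp only [conjExp, e, e']
  refine h3.congr_deriv ?_
  simp only [Ring.lie_def, smul_sub, mul_add, add_mul, mul_sub, sub_mul, mul_assoc,
    smul_mul_assoc, mul_smul_comm, neg_mul, mul_neg, Pi.mul_apply]
  abel

theorem hasDerivAt_conjExp (H A : 𝔄) (t : ℝ) :
    HasDerivAt (fun s => conjExp H s A) (conjExp H t (Complex.I • ⁅H, A⁆)) t := by
  simpa using hasDerivAt_conjExp_comp H (hasDerivAt_const t A)

/-- Remainder of the first-order expansion of the evolution in time. -/
theorem norm_conjExp_sub_self_sub_smul_le (H A : 𝔄) {t C : ℝ}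
    (hC : ∀ s, |s| ≤ |t| →
      ‖conjExp H s (Complex.I • ⁅H, A⁆) - Complex.I • ⁅H, A⁆‖ ≤ C) :
    ‖conjExp H t A - A - t • (Complex.I • ⁅H, A⁆)‖ ≤ C * |t| := by
  have h1 : ∀ s : ℝ, HasDerivAt (fun s : ℝ => C * s) C s := fun s => by
    simpa using (hasDerivAt_id s).const_mul C
  have h2 : ∀ s : ℝ, HasDerivAt (fun s : ℝ => conjExp H s A - A - s • (Complex.I • ⁅H, A⁆))
      (conjExp H s (Complex.I • ⁅H, A⁆) - Complex.I • ⁅H, A⁆) s := fun s => by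
    have h := (hasDerivAt_id s).smul_const (Complex.I • ⁅H, A⁆)
    rw [one_smul] at h
    exact ((hasDerivAt_conjExp H A s).sub_const A).sub h
  exact norm_le_of_norm_deriv_le_abs h2 h1 (by simp [conjExp_zero_time]) t hC

/-- The interaction picture: undoing the evolution by `H` with the evolution by `K` is generated
by the commutator with `K - H` alone. -/
theorem hasDerivAt_conjExp_conjExp_neg (H K B : 𝔄) (t : ℝ) :
    HasDerivAt (fun s => conjExp K s (conjExp H (-s) B))
      (conjExp K t (Complex.I • ⁅K - H, conjExp H (-t) B⁆)) t := by
  have h1 : HasDerivAt (fun s => conjExp H (-s) B) (-(Complex.I • ⁅H, conjExp H (-t) B⁆)) t := by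
    have h := HasDerivAt.scomp t (hasDerivAt_conjExp H B (-t)) (hasDerivAt_neg t)
    refine h.congr_deriv ?_
    rw [conjExp_smul, conjExp_lie, conjExp_eq_self_of_commute (Commute.refl H)]
    simp
  refine (hasDerivAt_conjExp_comp K h1).congr_deriv ?_
  rw [← sub_eq_add_neg, ← smul_sub]
  simp only [Ring.lie_def, sub_mul, mul_sub]
  congr 2
  abel

variable [StarRing 𝔄] [CStarRing 𝔄] [StarModule ℂ 𝔄]

theorem exp_smul_mem_unitary {H : 𝔄} (hH : IsSelfAdjoint H) (t : ℝ) :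
    NormedSpace.exp ((Complex.I * t) • H) ∈ unitary 𝔄 := by
  rw [Unitary.mem_iff, star_exp_smul hH]
  refine ⟨exp_neg_mul_exp H t, ?_⟩
  simpa using exp_neg_mul_exp H (-t)

theorem norm_conjExp {H : 𝔄} (hH : IsSelfAdjoint H) (t : ℝ) (A : 𝔄) : ‖conjExp H t A‖ = ‖A‖ := by
  rw [conjExp, ← star_exp_smul hH,
    CStarRing.norm_mul_mem_unitary _ (Unitary.star_mem (exp_smul_mem_unitary hH t)),
    CStarRing.norm_mem_unitary_mul _ (exp_smul_mem_unitary hH t)]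

theorem norm_lie_conjExp_neg {H : 𝔄} (hH : IsSelfAdjoint H) (t : ℝ) (A B : 𝔄) :
    ‖⁅A, conjExp H (-t) B⁆‖ = ‖⁅conjExp H t A, B⁆‖ := by
  rw [← norm_conjExp hH t, conjExp_lie, conjExp_conjExp_neg]

theorem enorm_lie_conjExp_neg {H : 𝔄} (hH : IsSelfAdjoint H) (t : ℝ) (A B : 𝔄) :
    ‖⁅A, conjExp H (-t) B⁆‖ₑ = ‖⁅conjExp H t A, B⁆‖ₑ := by
  rw [← ofReal_norm, norm_lie_conjExp_neg hH, ofReal_norm]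

theorem enorm_conjExp {H : 𝔄} (hH : IsSelfAdjoint H) (t : ℝ) (A : 𝔄) :
    ‖conjExp H t A‖ₑ = ‖A‖ₑ := by
  rw [← ofReal_norm, norm_conjExp hH, ofReal_norm]

/-- Two evolutions stay close as long as the difference of the Hamiltonians almost commutes with
the evolved observable. -/
theorem norm_conjExp_sub_conjExp_le {H K : 𝔄} (hK : IsSelfAdjoint K)
    (A : 𝔄) {t M : ℝ} (hM : ∀ s, |s| ≤ |t| → ‖⁅K - H, conjExp H s A⁆‖ ≤ M) :
    ‖conjExp H t A - conjExp K t A‖ ≤ M * |t| := by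
  have h1 : ∀ s, HasDerivAt (fun s => conjExp K s (conjExp H (-s) A) - A)
      (conjExp K s (Complex.I • ⁅K - H, conjExp H (-s) A⁆)) s := fun s =>
    (hasDerivAt_conjExp_conjExp_neg H K A s).sub_const A
  have h2 : ∀ s : ℝ, HasDerivAt (fun s : ℝ => M * s) M s := fun s => by
    simpa using (hasDerivAt_id s).const_mul M
  have h3 := norm_le_of_norm_deriv_le_abs h1 h2 (by simp [conjExp_zero_time]) (-t)
    (fun s hs => by
      rw [norm_conjExp hK, norm_smul, Complex.norm_I, one_mul]
      exact hM _ (by simpa using hs))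
  rw [abs_neg, neg_neg] at h3
  rwa [← norm_conjExp hK (-t), conjExp_sub_right, conjExp_neg_conjExp]

theorem norm_conjExp_sub_self_le {H : 𝔄} (hH : IsSelfAdjoint H) (A : 𝔄) (t : ℝ) :
    ‖conjExp H t A - A‖ ≤ ‖⁅H, A⁆‖ * |t| := by
  have h2 : ∀ s : ℝ, HasDerivAt (fun s : ℝ => ‖⁅H, A⁆‖ * s) ‖⁅H, A⁆‖ s := fun s => by
    simpa using (hasDerivAt_id s).const_mul ‖⁅H, A⁆‖
  refine norm_le_of_norm_deriv_le_abs (fun s => (hasDerivAt_conjExp H A s).sub_const A) h2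
    (by simp [conjExp_zero_time]) t fun s _ => ?_
  rw [norm_conjExp hH, norm_smul, Complex.norm_I, one_mul]

/-- The commutator of an evolved observable `A` grows only through the part `H - K` of the
Hamiltonian `H`, when `K` commutes with `A`. -/
theorem norm_lie_conjExp_le {H K A : 𝔄} (hH : IsSelfAdjoint H) (hK : IsSelfAdjoint K)
    (hKA : Commute K A) (B : 𝔄) {p p' : ℝ → ℝ} (hp : ∀ s, HasDerivAt p (p' s) s)
    (h0 : ‖⁅A, B⁆‖ ≤ p 0) {t : ℝ}
    (hb : ∀ s, |s| ≤ |t| → 2 * ‖A‖ * ‖⁅conjExp H s (H - K), B⁆‖ ≤ p' |s|) :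
    ‖⁅conjExp H t A, B⁆‖ ≤ p |t| := by
  -- Since the evolution by `K` fixes `A`, it may be inserted into the commutator.
  have e : ∀ s, ‖⁅conjExp H s A, B⁆‖ = ‖⁅A, conjExp K s (conjExp H (-s) B)⁆‖ := fun s => by
    conv_rhs => rw [← conjExp_eq_self_of_commute hKA s]
    rw [← conjExp_lie, norm_conjExp hK, norm_lie_conjExp_neg hH]
  have h1 : ∀ s, HasDerivAt (fun s => ⁅A, conjExp K s (conjExp H (-s) B)⁆)
      ⁅A, conjExp K s (Complex.I • ⁅K - H, conjExp H (-s) B⁆)⁆ s := fun s => by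
    have h := hasDerivAt_conjExp_conjExp_neg H K B s
    simp only [Ring.lie_def] at h ⊢
    exact (h.const_mul A).sub (h.mul_const A)
  rw [e]
  refine norm_le_of_norm_deriv_le_abs h1 hp (by simpa [conjExp_zero_time] using h0) t
    fun s hs => ?_
  refine (norm_lie_le _ _).trans ((le_of_eq ?_).trans (hb s hs))
  have e' : ∀ X : 𝔄, ⁅K - H, X⁆ = -⁅H - K, X⁆ := fun X => by
    simp only [Ring.lie_def, mul_sub, sub_mul]
    abel
  rw [norm_conjExp hK, norm_smul, Complex.norm_I, one_mul, e', norm_neg,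
    norm_lie_conjExp_neg hH]

end CStar

/-! ### Local observables -/

section Local

variable {Γ : Type*} [DecidableEq Γ] {d : Γ → ℕ}

/-- The local observable `a ⊗ 1` as an element of the quasi-local algebra. -/
def localElem (X : Finset Γ) (a : LocalMatrix d X) : QuasiLocal d :=
  ⟨localRep d X a, by
    have h : localRep d X a ∈ (quasiLocalAlgebra d : Set (ConfigSpace d →L[ℂ] ConfigSpace d)) := by
      rw [coe_quasiLocalAlgebra]
      exact subset_closure (Set.mem_iUnion.2 ⟨X, a, rfl⟩)
    exact h⟩

theorem localElem_mem (X : Finset Γ) (a : LocalMatrix d X) :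
    localElem X a ∈ localAlgebra d X := ⟨a, rfl⟩

theorem exists_localElem_eq {X : Finset Γ} {A : QuasiLocal d} (hA : A ∈ localAlgebra d X) :
    ∃ a, localElem X a = A := by
  obtain ⟨a, ha⟩ := hA
  exact ⟨a, Subtype.ext ha⟩

/-- Local observables are dense. -/
theorem dense_local (d : Γ → ℕ) :
    Dense {A : QuasiLocal d | ∃ X, A ∈ localAlgebra d X} := by
  rw [Subtype.dense_iff]
  intro T hT
  have h : T ∈ (quasiLocalAlgebra d : Set (ConfigSpace d →L[ℂ] ConfigSpace d)) := hT
  rw [coe_quasiLocalAlgebra] at h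
  refine closure_mono ?_ h
  rintro S hS
  obtain ⟨X, a, ha⟩ := Set.mem_iUnion.1 hS
  exact ⟨localElem X a, ⟨X, localElem_mem X a⟩, ha⟩

theorem patch_comm {X Y : Finset Γ} (h : Disjoint X Y) (σ : Config d) (τ : LocalConfig d X)
    (ρ : LocalConfig d Y) : patch Y (patch X σ τ) ρ = patch X (patch Y σ ρ) τ := by
  funext x
  by_cases hx : x ∈ X
  · simp [patch, hx, Finset.disjoint_left.1 h hx]
  · by_cases hy : x ∈ Y <;> simp [patch, hx, hy]

theorem restr_patch_of_disjoint {X Y : Finset Γ} (h : Disjoint X Y) (σ : Config d)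
    (τ : LocalConfig d X) : restr Y (patch X σ τ) = restr Y σ := by
  funext x
  simp [restr, patch, Finset.disjoint_right.1 h x.2]

/-- Observables localised in disjoint sets commute. -/
theorem commute_of_disjoint {X Y : Finset Γ} (h : Disjoint X Y) {A B : QuasiLocal d}
    (hA : A ∈ localAlgebra d X) (hB : B ∈ localAlgebra d Y) : Commute A B := by
  obtain ⟨a, rfl⟩ := exists_localElem_eq hA
  obtain ⟨b, rfl⟩ := exists_localElem_eq hB
  refine Subtype.ext ?_
  change localRep d X a * localRep d Y b = localRep d Y b * localRep d X a
  ext ψ σ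
  simp only [mul_apply_eq_comp, localRep_apply, restr_patch_of_disjoint h,
    restr_patch_of_disjoint h.symm, Finset.mul_sum, patch_comm h]
  rw [Finset.sum_comm]
  exact Finset.sum_congr rfl fun _ _ => Finset.sum_congr rfl fun _ _ => mul_left_comm _ _ _

/-- The matrix unit of `X` that takes the configuration `τ` in `X` to the configuration `σ`. The
indices are configurations of the whole system, of which only the parts in `X` matter, so that the
same pair serves all the finite sets. -/
def matrixUnit (X : Finset Γ) (σ τ : Config d) : QuasiLocal d :=
  localElem X (Matrix.single (restr X σ) (restr X τ) 1)

theorem coe_matrixUnit_apply (X : Finset Γ) (σ τ : Config d) (ψ : ConfigSpace d) (ρ : Config d) :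
    ((matrixUnit X σ τ : ConfigSpace d →L[ℂ] ConfigSpace d) ψ ρ : ℂ) =
      if restr X ρ = restr X σ then (ψ (patch X ρ (restr X τ)) : ℂ) else 0 := by
  change (localRep d X _ ψ ρ : ℂ) = _
  rw [localRep_apply, Finset.sum_eq_single (restr X τ)]
  · by_cases h : restr X ρ = restr X σ
    · simp [h]
    · simp [h, Ne.symm h]
  · intro b _ hb
    simp [hb.symm]
  · simp

theorem matrixUnit_empty (σ τ : Config d) : matrixUnit ∅ σ τ = 1 := by
  refine Subtype.ext ?_
  ext ψ ρ
  rw [coe_matrixUnit_apply, if_pos (Subsingleton.elim _ _),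
    Subsingleton.elim (restr ∅ τ) (restr ∅ ρ), patch_restr]
  rfl

/-- Matrix units are products of matrix units at single sites. -/
theorem matrixUnit_insert {X : Finset Γ} {y : Γ} (hy : y ∉ X) (σ τ : Config d) :
    matrixUnit (insert y X) σ τ = matrixUnit {y} σ τ * matrixUnit X σ τ := by
  have hd : Disjoint {y} X := Finset.disjoint_singleton_left.2 hy
  refine Subtype.ext ?_
  ext ψ ρ
  change _ = ((matrixUnit {y} σ τ : ConfigSpace d →L[ℂ] ConfigSpace d)
    ((matrixUnit X σ τ : ConfigSpace d →L[ℂ] ConfigSpace d) ψ) ρ : ℂ)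
  rw [coe_matrixUnit_apply, coe_matrixUnit_apply, coe_matrixUnit_apply,
    restr_patch_of_disjoint hd]
  have h1 : restr (insert y X) ρ = restr (insert y X) σ ↔
      restr {y} ρ = restr {y} σ ∧ restr X ρ = restr X σ := by
    simp only [funext_iff, restr, Subtype.forall, Finset.forall_mem_insert, Finset.mem_singleton,
      forall_eq]
  have h2 : patch (insert y X) ρ (restr (insert y X) τ) =
      patch X (patch {y} ρ (restr {y} τ)) (restr X τ) := by
    funext x
    by_cases hx : x = y
    · subst hx
      simp [patch, restr, hy]
    · by_cases hx' : x ∈ X <;> simp [patch, restr, hx, hx']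
  rw [h2]
  by_cases ha : restr {y} ρ = restr {y} σ <;> by_cases hb : restr X ρ = restr X σ <;>
    simp [h1, ha, hb]

/-- A matrix unit `E` has norm at most one, because `star E * E` is a projection. -/
theorem norm_localElem_single_le (X : Finset Γ) (s t : LocalConfig d X) :
    ‖localElem X (Matrix.single s t (1 : ℂ))‖ ≤ 1 := by
  have key : ∀ a b : LocalMatrix d X, localElem X a * localElem X b = localElem X (a * b) :=
    fun a b => Subtype.ext (map_mul (localRep d X) a b).symm
  have hstar : ∀ a : LocalMatrix d X, star (localElem X a) = localElem X (star a) :=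
    fun a => Subtype.ext (map_star (localRep d X) a).symm
  have e : ∀ s t : LocalConfig d X,
      star (Matrix.single s t (1 : ℂ)) = Matrix.single t s (1 : ℂ) := fun s t => by
    rw [Matrix.star_eq_conjTranspose, Matrix.conjTranspose_single, star_one]
  have h1 : ‖localElem X (Matrix.single s t (1 : ℂ))‖ * ‖localElem X (Matrix.single s t (1 : ℂ))‖
      = ‖localElem X (Matrix.single t t (1 : ℂ))‖ := by
    rw [← CStarRing.norm_star_mul_self, hstar, key, e, Matrix.single_mul_single_same, one_mul]
  have h2 : ‖localElem X (Matrix.single t t (1 : ℂ))‖ * ‖localElem X (Matrix.single t t (1 : ℂ))‖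
      = ‖localElem X (Matrix.single t t (1 : ℂ))‖ := by
    rw [← CStarRing.norm_star_mul_self, hstar, key, e, Matrix.single_mul_single_same, one_mul]
  have h3 : ‖localElem X (Matrix.single t t (1 : ℂ))‖ ≤ 1 := by
    nlinarith [norm_nonneg (localElem X (Matrix.single t t (1 : ℂ)))]
  nlinarith [norm_nonneg (localElem X (Matrix.single s t (1 : ℂ)))]

theorem norm_matrixUnit_le (X : Finset Γ) (σ τ : Config d) : ‖matrixUnit X σ τ‖ ≤ 1 :=
  norm_localElem_single_le X _ _

/-- Matrix entries are bounded by the operator norm. -/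
theorem norm_entry_le [∀ x, NeZero (d x)] (X : Finset Γ) (a : LocalMatrix d X)
    (s t : LocalConfig d X) : ‖a s t‖ ≤ ‖localElem X a‖ := by
  classical
  let σ : Config d := patch X (fun _ => 0) s
  let τ : Config d := patch X (fun _ => 0) t
  have h1 : (localRep d X a (lp.single 2 τ (1 : ℂ)) σ : ℂ) = a s t := by
    have e : ∀ ρ : LocalConfig d X, patch X σ ρ = τ ↔ ρ = t := fun ρ => by
      rw [patch_patch]
      exact ⟨fun h => by simpa [τ] using congrArg (restr X) h, fun h => by rw [h]⟩
    have e' : ∀ ρ : LocalConfig d X, patch X (fun _ => 0) ρ = τ ↔ ρ = t := fun ρ => by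
      rw [← e, patch_patch]
    simp [localRep_apply, lp.single_apply, Pi.single_apply, e', σ]
  have h2 := lp.norm_apply_le_norm (p := 2) two_ne_zero
    (localRep d X a (lp.single 2 τ (1 : ℂ))) σ
  rw [h1] at h2
  refine h2.trans (((localRep d X a).le_opNorm _).trans ?_)
  rw [lp.norm_single (by norm_num), norm_one, mul_one]
  exact le_rfl

theorem localElem_eq_sum (X : Finset Γ) (a : LocalMatrix d X) :
    localElem X a = ∑ s, ∑ t, a s t • localElem X (Matrix.single s t (1 : ℂ)) := by
  refine Subtype.ext ?_
  change localRep d X a = _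
  conv_lhs => rw [Matrix.matrix_eq_sum_single a]
  simp only [map_sum, AddSubmonoidClass.coe_finsetSum]
  refine Finset.sum_congr rfl fun s _ => Finset.sum_congr rfl fun t _ => ?_
  change _ = a s t • localRep d X (Matrix.single s t (1 : ℂ))
  rw [← map_smul, Matrix.smul_single, smul_eq_mul, mul_one]

theorem enorm_matrixUnit_lie_le (X : Finset Γ) (σ τ : Config d) (B : QuasiLocal d)
    {c : Γ → ℝ≥0∞} (hc : ∀ y, ∀ A ∈ localAlgebra d {y}, ‖⁅A, B⁆‖ₑ ≤ ‖A‖ₑ * c y) :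
    ‖⁅matrixUnit X σ τ, B⁆‖ₑ ≤ ∑ y ∈ X, c y := by
  have hu : ∀ Y : Finset Γ, ‖matrixUnit Y σ τ‖ₑ ≤ 1 := fun Y => by
    rw [← ofReal_norm]
    exact ENNReal.ofReal_le_one.2 (norm_matrixUnit_le Y σ τ)
  induction X using Finset.induction_on with
  | empty => rw [matrixUnit_empty, enorm_lie_of_commute (Commute.one_left B)]; exact zero_le
  | insert y X hy ih =>
    rw [matrixUnit_insert hy, Finset.sum_insert hy]
    refine (enorm_mul_lie_le _ _ _).trans (add_le_add ?_ ?_)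
    · calc _ ≤ (‖matrixUnit {y} σ τ‖ₑ * c y) * 1 :=
          mul_le_mul' (hc y _ (localElem_mem _ _)) (hu X)
        _ ≤ (1 * c y) * 1 := by gcongr; exact hu _
        _ = c y := by rw [one_mul, mul_one]
    · calc _ ≤ 1 * ∑ y ∈ X, c y := mul_le_mul' (hu _) ih
        _ = _ := one_mul _

/-- Commutators with observables of `X` are controlled by commutators with observables at the
single sites of `X`: such an observable is a combination of at most `N ^ (2 * |X|)` products of
one-site matrix units. -/
theorem enorm_lie_le_of_mem_local {N : ℕ} (hd_pos : ∀ x, 0 < d x) (hd_le : ∀ x, d x ≤ N)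
    {X : Finset Γ} {A : QuasiLocal d} (hA : A ∈ localAlgebra d X) (B : QuasiLocal d)
    {c : Γ → ℝ≥0∞} (hc : ∀ y, ∀ A ∈ localAlgebra d {y}, ‖⁅A, B⁆‖ₑ ≤ ‖A‖ₑ * c y) :
    ‖⁅A, B⁆‖ₑ ≤ ‖A‖ₑ * (N : ℝ≥0∞) ^ (2 * X.card) * ∑ y ∈ X, c y := by
  have : ∀ x, NeZero (d x) := fun x => ⟨(hd_pos x).ne'⟩
  obtain ⟨a, rfl⟩ := exists_localElem_eq hA
  have hcard : (Fintype.card (LocalConfig d X) : ℝ≥0∞) ≤ (N : ℝ≥0∞) ^ X.card := by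
    have h : Fintype.card (LocalConfig d X) ≤ N ^ X.card := by
      rw [Fintype.card_pi, ← Fintype.card_coe X, ← Finset.card_univ]
      exact Finset.prod_le_pow_card _ _ _ fun x _ => by simpa using hd_le x
    exact_mod_cast h
  have hst : ∀ s t, ‖⁅a s t • localElem X (Matrix.single s t (1 : ℂ)), B⁆‖ₑ ≤
      ‖localElem X a‖ₑ * ∑ y ∈ X, c y := fun s t => by
    have h1 : ‖a s t‖ₑ ≤ ‖localElem X a‖ₑ := by
      simp only [← ofReal_norm]
      exact ENNReal.ofReal_le_ofReal (norm_entry_le X a s t)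
    have h2 := enorm_matrixUnit_lie_le X (patch X (fun _ => 0) s) (patch X (fun _ => 0) t) B hc
    rw [matrixUnit, restr_patch, restr_patch] at h2
    rw [enorm_smul_lie]
    exact mul_le_mul' h1 h2
  conv_lhs => rw [localElem_eq_sum X a]
  calc _ ≤ ∑ s, ∑ t, ‖⁅a s t • localElem X (Matrix.single s t (1 : ℂ)), B⁆‖ₑ :=
        (enorm_sum_lie_le _ _ _).trans (Finset.sum_le_sum fun s _ => enorm_sum_lie_le _ _ _)
    _ ≤ ∑ _s : LocalConfig d X, ∑ _t : LocalConfig d X, ‖localElem X a‖ₑ * ∑ y ∈ X, c y :=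
        Finset.sum_le_sum fun s _ => Finset.sum_le_sum fun t _ => hst s t
    _ = ‖localElem X a‖ₑ * ((Fintype.card (LocalConfig d X) : ℝ≥0∞) *
          (Fintype.card (LocalConfig d X) : ℝ≥0∞)) * ∑ y ∈ X, c y := by
        simp only [Finset.sum_const, nsmul_eq_mul, Finset.card_univ]
        ring
    _ ≤ _ := by
        rw [two_mul, pow_add]
        gcongr

end Local

/-! ### Propagation of weights along chains of interacting sets -/

section Hop

variable {Γ : Type*}

/-- One step of propagation: from the site `x` the weight `f` is collected at all the sites of the
sets `Z ∋ x`, each set counting with its strength `w Z`. -/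
def hop (w : Finset Γ → ℝ≥0∞) (f : Γ → ℝ≥0∞) (x : Γ) : ℝ≥0∞ :=
  ∑' Z : {Z : Finset Γ // x ∈ Z}, w Z.1 * ∑ y ∈ Z.1, f y

/-- Propagation for the time `t`: the series `∑ (2t)^k / k! • hop^k`. The factor `2` stems from
`‖[A, A']‖ ≤ 2 ‖A‖ ‖A'‖`. -/
def hopExp (w : Finset Γ → ℝ≥0∞) (t : ℝ) (f : Γ → ℝ≥0∞) (x : Γ) : ℝ≥0∞ :=
  ∑' k : ℕ, ENNReal.ofReal ((2 * t) ^ k / k.factorial) * (hop w)^[k] f x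

variable {w : Finset Γ → ℝ≥0∞}

theorem hop_mono {f g : Γ → ℝ≥0∞} (h : f ≤ g) : hop w f ≤ hop w g := fun x =>
  ENNReal.tsum_le_tsum fun Z => by
    gcongr with y
    exact h y

theorem hop_tsum {ι : Type*} (f : ι → Γ → ℝ≥0∞) :
    hop w (fun x => ∑' i, f i x) = fun x => ∑' i, hop w (f i) x := by
  funext x
  simp only [hop]
  rw [ENNReal.tsum_comm]
  refine tsum_congr fun Z => ?_
  rw [ENNReal.tsum_mul_left, Summable.tsum_finsetSum fun _ _ => ENNReal.summable]

theorem hop_mul_const (f : Γ → ℝ≥0∞) (c : ℝ≥0∞) :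
    hop w (fun x => f x * c) = fun x => hop w f x * c := by
  funext x
  simp only [hop, ← ENNReal.tsum_mul_right, ← Finset.sum_mul, mul_assoc]

theorem hop_sum_mul {ι : Type*} (s : Finset ι) (a : ι → ℝ≥0∞) (f : ι → Γ → ℝ≥0∞) (x : Γ) :
    hop w (fun y => ∑ i ∈ s, a i * f i y) x = ∑ i ∈ s, a i * hop w (f i) x := by
  simp only [hop, ← ENNReal.tsum_mul_left]
  rw [← Summable.tsum_finsetSum fun _ _ => ENNReal.summable]
  refine tsum_congr fun Z => ?_
  rw [Finset.sum_comm, Finset.mul_sum]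
  refine Finset.sum_congr rfl fun i _ => ?_
  rw [← Finset.mul_sum]
  ring

theorem hop_iterate_mono {f g : Γ → ℝ≥0∞} (h : f ≤ g) (k : ℕ) :
    (hop w)^[k] f ≤ (hop w)^[k] g :=
  Monotone.iterate (fun _ _ h => hop_mono h) k h

theorem hop_iterate_tsum {ι : Type*} (f : ι → Γ → ℝ≥0∞) (k : ℕ) :
    (hop w)^[k] (fun x => ∑' i, f i x) = fun x => ∑' i, (hop w)^[k] (f i) x := by
  induction k with
  | zero => rfl
  | succ k ih => simp only [Function.iterate_succ_apply', ih, hop_tsum]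

theorem hop_iterate_mul_const (f : Γ → ℝ≥0∞) (c : ℝ≥0∞) (k : ℕ) :
    (hop w)^[k] (fun x => f x * c) = fun x => (hop w)^[k] f x * c := by
  induction k with
  | zero => rfl
  | succ k ih => simp only [Function.iterate_succ_apply', ih, hop_mul_const]

theorem hopExp_mono {f g : Γ → ℝ≥0∞} (h : f ≤ g) (t : ℝ) : hopExp w t f ≤ hopExp w t g :=
  fun x => ENNReal.tsum_le_tsum fun k => by
    gcongr
    exact hop_iterate_mono h k x

theorem hopExp_tsum {ι : Type*} (f : ι → Γ → ℝ≥0∞) (t : ℝ) (x : Γ) :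
    hopExp w t (fun x => ∑' i, f i x) x = ∑' i, hopExp w t (f i) x := by
  simp only [hopExp]
  rw [ENNReal.tsum_comm]
  refine tsum_congr fun k => ?_
  rw [hop_iterate_tsum, ENNReal.tsum_mul_left]

theorem hopExp_mono_time {s t : ℝ} (hs : 0 ≤ s) (hst : s ≤ t) (f : Γ → ℝ≥0∞) (x : Γ) :
    hopExp w s f x ≤ hopExp w t f x :=
  ENNReal.tsum_le_tsum fun k => by gcongr

theorem tsum_ofReal_pow_div_factorial {r K : ℝ} (hr : 0 ≤ r) (hK : 0 ≤ K) :
    ∑' k : ℕ, ENNReal.ofReal (r ^ k / k.factorial) * ENNReal.ofReal K ^ k =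
      ENNReal.ofReal (Real.exp (r * K)) := by
  have h : HasSum (fun k : ℕ => (r * K) ^ k / k.factorial) (Real.exp (r * K)) := by
    rw [Real.exp_eq_exp_ℝ]
    exact NormedSpace.expSeries_div_hasSum_exp (r * K)
  rw [← h.tsum_eq, ENNReal.ofReal_tsum_of_nonneg (fun k => by positivity) h.summable]
  refine tsum_congr fun k => ?_
  rw [← ENNReal.ofReal_pow hK, ← ENNReal.ofReal_mul (by positivity), mul_pow]
  ring_nf

theorem tsum_ofReal_pow_div_factorial_succ {r K : ℝ} (hr : 0 ≤ r) (hK : 0 ≤ K) :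
    ∑' k : ℕ, ENNReal.ofReal (r ^ (k + 1) / (k + 1).factorial) * ENNReal.ofReal K ^ (k + 1) =
      ENNReal.ofReal (Real.exp (r * K) - 1) := by
  have h := tsum_ofReal_pow_div_factorial hr hK
  rw [tsum_eq_zero_add' ENNReal.summable] at h
  simp only [pow_zero, Nat.factorial_zero, Nat.cast_one, div_one, ENNReal.ofReal_one, mul_one] at h
  rw [ENNReal.ofReal_sub _ zero_le_one, ← h, ENNReal.ofReal_one,
    ENNReal.add_sub_cancel_left ENNReal.one_ne_top]

theorem hop_const_le {κ : ℝ≥0∞}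
    (hκ : ∀ x, ∑' Z : {Z : Finset Γ // x ∈ Z}, (Z.1.card : ℝ≥0∞) * w Z.1 ≤ κ)
    (M : ℝ≥0∞) (x : Γ) : hop w (fun _ => M) x ≤ κ * M := by
  simp only [hop, Finset.sum_const, nsmul_eq_mul]
  calc _ = (∑' Z : {Z : Finset Γ // x ∈ Z}, (Z.1.card : ℝ≥0∞) * w Z.1) * M := by
        rw [← ENNReal.tsum_mul_right]
        exact tsum_congr fun Z => by ring
    _ ≤ κ * M := by gcongr; exact hκ x

theorem hop_iterate_const_le {κ : ℝ≥0∞}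
    (hκ : ∀ x, ∑' Z : {Z : Finset Γ // x ∈ Z}, (Z.1.card : ℝ≥0∞) * w Z.1 ≤ κ)
    (M : ℝ≥0∞) (k : ℕ) (x : Γ) : (hop w)^[k] (fun _ => M) x ≤ κ ^ k * M := by
  induction k generalizing x with
  | zero => simp
  | succ k ih =>
    rw [Function.iterate_succ_apply']
    calc _ ≤ hop w (fun _ => κ ^ k * M) x := hop_mono ih x
      _ ≤ κ * (κ ^ k * M) := hop_const_le hκ _ x
      _ = _ := by ring

theorem hopExp_const_le {K : ℝ} (hK : 0 ≤ K)
    (hκ : ∀ x, ∑' Z : {Z : Finset Γ // x ∈ Z}, (Z.1.card : ℝ≥0∞) * w Z.1 ≤ ENNReal.ofReal K)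
    (M : ℝ≥0∞) {t : ℝ} (ht : 0 ≤ t) (x : Γ) :
    hopExp w t (fun _ => M) x ≤ ENNReal.ofReal (Real.exp (2 * t * K)) * M := by
  rw [← tsum_ofReal_pow_div_factorial (by positivity) hK, ← ENNReal.tsum_mul_right, hopExp]
  refine ENNReal.tsum_le_tsum fun k => ?_
  rw [mul_assoc]
  gcongr
  exact hop_iterate_const_le hκ M k x

/-- Differentiating the truncated exponential series shifts its coefficients. -/
theorem hasDerivAt_sum_pow_div_factorial (a : ℝ) (b : ℕ → ℝ) (n : ℕ) (s : ℝ) :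
    HasDerivAt (fun s : ℝ => a * ∑ k ∈ Finset.range (n + 1), (2 * s) ^ k / k.factorial * b k)
      (2 * a * ∑ k ∈ Finset.range n, (2 * s) ^ k / k.factorial * b (k + 1)) s := by
  have h : ∀ k : ℕ, HasDerivAt (fun s : ℝ => (2 * s) ^ (k + 1) / (k + 1).factorial * b (k + 1))
      (2 * ((2 * s) ^ k / k.factorial * b (k + 1))) s := fun k => by
    have h1 := ((((hasDerivAt_id s).const_mul 2).pow (k + 1)).div_const
      ((k + 1).factorial : ℝ)).mul_const (b (k + 1))
    refine h1.congr_deriv ?_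
    have h2 : (k.factorial : ℝ) ≠ 0 := by positivity
    have h3 : (k : ℝ) + 1 ≠ 0 := by positivity
    simp only [Nat.factorial_succ, Nat.cast_mul, Nat.cast_add, Nat.cast_one, id,
      Nat.add_sub_cancel, mul_one]
    field_simp
  have h4 : HasDerivAt
      (fun s : ℝ => ∑ k ∈ Finset.range n, (2 * s) ^ (k + 1) / (k + 1).factorial * b (k + 1))
      (∑ k ∈ Finset.range n, 2 * ((2 * s) ^ k / k.factorial * b (k + 1))) s :=
    HasDerivAt.fun_sum fun k _ => h k
  have h5 := (h4.add_const ((1 : ℝ) * b 0)).const_mul a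
  simp only [Finset.sum_range_succ', pow_zero, Nat.factorial_zero, Nat.cast_one, div_one]
  refine h5.congr_deriv ?_
  rw [← Finset.mul_sum]
  ring

theorem ofReal_mul_sum_pow_div_factorial {a r : ℝ} (ha : 0 ≤ a) (hr : 0 ≤ r) {b : ℕ → ℝ≥0∞}
    (hb : ∀ k, b k ≠ ⊤) (n : ℕ) :
    ENNReal.ofReal (a * ∑ k ∈ Finset.range n, r ^ k / k.factorial * (b k).toReal) =
      ENNReal.ofReal a * ∑ k ∈ Finset.range n, ENNReal.ofReal (r ^ k / k.factorial) * b k := by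
  rw [ENNReal.ofReal_mul ha, ENNReal.ofReal_sum_of_nonneg fun k _ => by positivity]
  congr 1
  refine Finset.sum_congr rfl fun k _ => ?_
  rw [ENNReal.ofReal_mul (by positivity), ENNReal.ofReal_toReal (hb k)]

/-- The coefficients of the bound obtained after `n` iterations: the first `n` are those of the
exponential series, the remaining ones are the crude bounds for them. -/
def truncHop (w : Finset Γ → ℝ≥0∞) (κ M : ℝ≥0∞) (c : Γ → ℝ≥0∞) (n k : ℕ) : Γ → ℝ≥0∞ :=
  if k < n then (hop w)^[k] c else fun _ => κ ^ k * M

theorem truncHop_le {κ M : ℝ≥0∞} {c : Γ → ℝ≥0∞}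
    (hκ : ∀ x, ∑' Z : {Z : Finset Γ // x ∈ Z}, (Z.1.card : ℝ≥0∞) * w Z.1 ≤ κ)
    (hc : ∀ x, c x ≤ M) (n k : ℕ) (x : Γ) :
    truncHop w κ M c n k x ≤ κ ^ k * M := by
  rw [truncHop]
  split_ifs
  · exact (hop_iterate_mono (g := fun _ => M) hc k x).trans (hop_iterate_const_le hκ M k x)
  · exact le_rfl

/-- One step of propagation, applied to the coefficients after `n` iterations, stays below the
shifted coefficients after `n + 1` iterations. -/
theorem hop_truncHop_le {κ M : ℝ≥0∞} {c : Γ → ℝ≥0∞}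
    (hκ : ∀ x, ∑' Z : {Z : Finset Γ // x ∈ Z}, (Z.1.card : ℝ≥0∞) * w Z.1 ≤ κ)
    (n k : ℕ) (x : Γ) :
    hop w (truncHop w κ M c n k) x ≤ truncHop w κ M c (n + 1) (k + 1) x := by
  simp only [truncHop, add_lt_add_iff_right]
  split_ifs
  · rw [Function.iterate_succ_apply']
  · refine (hop_const_le hκ _ x).trans (le_of_eq ?_)
    ring

variable [MetricSpace Γ] [DecidableEq Γ]

/-- A point source decays exponentially: a chain of sets from `x` to `y` has total diameter at
least `d(x, y)`. -/
theorem hop_iterate_single_le {κ : ℝ≥0∞} {lam : ℝ} (hlam : 0 ≤ lam)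
    (hκ : ∀ x, ∑' Z : {Z : Finset Γ // x ∈ Z}, (Z.1.card : ℝ≥0∞) * w Z.1 *
      ENNReal.ofReal (Real.exp (lam * Metric.diam (Z.1 : Set Γ))) ≤ κ) (k : ℕ) (x y : Γ) :
    (hop w)^[k] (Pi.single y 1) x ≤ κ ^ k * ENNReal.ofReal (Real.exp (-lam * dist x y)) := by
  induction k generalizing x with
  | zero =>
    by_cases h : x = y
    · subst h
      simp
    · simp [h]
  | succ k ih =>
    rw [Function.iterate_succ_apply', hop]
    calc _ ≤ ∑' Z : {Z : Finset Γ // x ∈ Z}, ((Z.1.card : ℝ≥0∞) * w Z.1 *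
          ENNReal.ofReal (Real.exp (lam * Metric.diam (Z.1 : Set Γ)))) *
          (κ ^ k * ENNReal.ofReal (Real.exp (-lam * dist x y))) := by
          refine ENNReal.tsum_le_tsum fun Z => ?_
          have hz : ∀ z ∈ Z.1, (hop w)^[k] (Pi.single y 1) z ≤ κ ^ k *
              (ENNReal.ofReal (Real.exp (lam * Metric.diam (Z.1 : Set Γ))) *
                ENNReal.ofReal (Real.exp (-lam * dist x y))) := by
            intro z hz
            refine (ih z).trans ?_
            gcongr
            rw [← ENNReal.ofReal_mul (Real.exp_pos _).le, ← Real.exp_add]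
            refine ENNReal.ofReal_le_ofReal (Real.exp_le_exp.2 ?_)
            have h1 : dist x z ≤ Metric.diam (Z.1 : Set Γ) :=
              Metric.dist_le_diam_of_mem Z.1.finite_toSet.isBounded Z.2 hz
            nlinarith [dist_triangle x z y]
          calc _ ≤ w Z.1 * ∑ _z ∈ Z.1, κ ^ k *
              (ENNReal.ofReal (Real.exp (lam * Metric.diam (Z.1 : Set Γ))) *
                ENNReal.ofReal (Real.exp (-lam * dist x y))) := by
                gcongr with z hz'
                exact hz z hz'
            _ = _ := by
                rw [Finset.sum_const, nsmul_eq_mul]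
                ring
      _ ≤ κ * (κ ^ k * ENNReal.ofReal (Real.exp (-lam * dist x y))) := by
          rw [ENNReal.tsum_mul_right]
          gcongr
          exact hκ x
      _ = _ := by ring

/-- Propagation is local up to exponential tails. -/
theorem hopExp_le {K lam : ℝ} (hK : 0 ≤ K) (hlam : 0 ≤ lam)
    (hκ : ∀ x, ∑' Z : {Z : Finset Γ // x ∈ Z}, (Z.1.card : ℝ≥0∞) * w Z.1 *
      ENNReal.ofReal (Real.exp (lam * Metric.diam (Z.1 : Set Γ))) ≤ ENNReal.ofReal K)
    {t : ℝ} (ht : 0 ≤ t) (f : Γ → ℝ≥0∞) (x : Γ) :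
    hopExp w t f x ≤ ENNReal.ofReal (Real.exp (2 * t * K)) * f x +
      ∑' y : {y : Γ // y ≠ x}, ENNReal.ofReal (Real.exp (-lam * dist x y.1)) *
        ENNReal.ofReal (Real.exp (2 * t * K) - 1) * f y.1 := by
  have hf : f = fun z => ∑' y, (Pi.single y 1 : Γ → ℝ≥0∞) z * f y := by
    funext z
    rw [tsum_eq_single z (fun y hy => by simp [hy.symm])]
    simp
  have h2t : 0 ≤ 2 * t := by positivity
  have key : ∀ y, hopExp w t (fun z => (Pi.single y 1 : Γ → ℝ≥0∞) z * f y) x =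
      hopExp w t (Pi.single y 1) x * f y := fun y => by
    simp only [hopExp, hop_iterate_mul_const, ← ENNReal.tsum_mul_right, mul_assoc]
  have hterm : ∀ (y : Γ) (k : ℕ),
      ENNReal.ofReal ((2 * t) ^ k / k.factorial) * (hop w)^[k] (Pi.single y 1) x ≤
        ENNReal.ofReal ((2 * t) ^ k / k.factorial) * ENNReal.ofReal K ^ k *
          ENNReal.ofReal (Real.exp (-lam * dist x y)) := fun y k => by
    rw [mul_assoc]
    gcongr
    exact hop_iterate_single_le hlam hκ k x y
  conv_lhs => rw [hf]
  rw [hopExp_tsum, ← ENNReal.summable.tsum_add_tsum_compl (s := {x}) ENNReal.summable]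
  refine add_le_add ?_ ?_
  · rw [tsum_singleton x (fun y => hopExp w t (fun z => (Pi.single y 1 : Γ → ℝ≥0∞) z * f y) x), key]
    gcongr
    rw [← tsum_ofReal_pow_div_factorial h2t hK, hopExp]
    refine ENNReal.tsum_le_tsum fun k => (hterm x k).trans ?_
    simp
  · refine ENNReal.tsum_le_tsum fun y : {y : Γ // y ≠ x} => ?_
    have hy : x ≠ y.1 := y.2.symm
    rw [key]
    gcongr
    -- the term of order zero vanishes
    rw [hopExp, tsum_eq_zero_add' ENNReal.summable, Function.iterate_zero, id,
      Pi.single_eq_of_ne hy, mul_zero, zero_add, ← tsum_ofReal_pow_div_factorial_succ h2t hK,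
      mul_comm (ENNReal.ofReal (Real.exp (-lam * _))), ← ENNReal.tsum_mul_right]
    exact ENNReal.tsum_le_tsum fun k => hterm y.1 (k + 1)

end Hop

/-! ### The Lieb-Robinson bound for finitely many interaction terms -/

section Lattice

variable {Γ : Type*} [DecidableEq Γ]

/-- A self-adjoint interaction in a `C*`-algebra with a net of sets of local observables, of which
only the following is kept: locality, density, and the fact that a commutator with an observable
of `X` is controlled, at the price of a factor `N ^ (2 * |X|)`, by commutators with the observables
of the single sites of `X`. -/
structure LatticeSystem (Γ : Type*) [DecidableEq Γ] (𝔄 : Type*) [NormedRing 𝔄] [StarRing 𝔄]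
    (N : ℕ) where
  /-- The observables localised in a finite set of sites. -/
  loc : Finset Γ → Set 𝔄
  /-- If there are sites at all, then `N ^ (2 * |X|)` is at least one. -/
  dim_pos : ∀ _ : Γ, 0 < N
  commute_of_disjoint : ∀ {X Y : Finset Γ}, Disjoint X Y → ∀ {A B : 𝔄}, A ∈ loc X → B ∈ loc Y →
    Commute A B
  dense_loc : Dense {A : 𝔄 | ∃ X, A ∈ loc X}
  enorm_lie_le_sites : ∀ {X : Finset Γ} {A : 𝔄}, A ∈ loc X → ∀ (B : 𝔄) {c : Γ → ℝ≥0∞},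
    (∀ y, ∀ A ∈ loc {y}, ‖⁅A, B⁆‖ₑ ≤ ‖A‖ₑ * c y) →
    ‖⁅A, B⁆‖ₑ ≤ ‖A‖ₑ * (N : ℝ≥0∞) ^ (2 * X.card) * ∑ y ∈ X, c y
  /-- The interaction term of a finite set of sites. -/
  term : Finset Γ → 𝔄
  term_mem : ∀ Z, term Z ∈ loc Z
  isSelfAdjoint_term : ∀ Z, IsSelfAdjoint (term Z)

namespace LatticeSystem

variable {𝔄 : Type*} [NormedRing 𝔄] [StarRing 𝔄] {N : ℕ} (𝒮 : LatticeSystem Γ 𝔄 N)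

/-- The Hamiltonian with the interaction terms of the sets in `S`. -/
def ham (S : Finset (Finset Γ)) : 𝔄 := ∑ Z ∈ S, 𝒮.term Z

/-- The strength `‖Φ(Z)‖ N^{2|Z|}` of the interaction in `Z`. -/
def strength (Z : Finset Γ) : ℝ≥0∞ := ‖𝒮.term Z‖ₑ * (N : ℝ≥0∞) ^ (2 * Z.card)

theorem isSelfAdjoint_ham (S : Finset (Finset Γ)) : IsSelfAdjoint (𝒮.ham S) :=
  isSelfAdjoint_sum S fun Z _ => 𝒮.isSelfAdjoint_term Z

theorem ham_sub_ham_filter (S : Finset (Finset Γ)) (x : Γ) :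
    𝒮.ham S - 𝒮.ham (S.filter fun Z => x ∉ Z) = 𝒮.ham (S.filter fun Z => x ∈ Z) := by
  rw [sub_eq_iff_eq_add]
  exact (Finset.sum_filter_add_sum_filter_not S (fun Z => x ∈ Z) 𝒮.term).symm

theorem commute_ham_filter (S : Finset (Finset Γ)) {x : Γ} {A : 𝔄} (hA : A ∈ 𝒮.loc {x}) :
    Commute (𝒮.ham (S.filter fun Z => x ∉ Z)) A := by
  refine Commute.sum_left _ _ _ fun Z hZ => ?_
  exact 𝒮.commute_of_disjoint (Finset.disjoint_singleton_right.2 (Finset.mem_filter.1 hZ).2)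
    (𝒮.term_mem Z) hA

variable [NormedAlgebra ℂ 𝔄] [CompleteSpace 𝔄] [CStarRing 𝔄] [StarModule ℂ 𝔄]

/-- Only the interaction terms that contain `x` matter for the growth of commutators with the
observables at `x`, and these terms are controlled by one step of propagation. -/
theorem enorm_lie_conjExp_ham_filter_le (S : Finset (Finset Γ)) (x : Γ) (s : ℝ) (B : 𝔄)
    {F : Γ → ℝ≥0∞}
    (hF : ∀ y, ∀ A ∈ 𝒮.loc {y}, ‖⁅conjExp (𝒮.ham S) s A, B⁆‖ₑ ≤ ‖A‖ₑ * F y) :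
    ‖⁅conjExp (𝒮.ham S) s (𝒮.ham (S.filter fun Z => x ∈ Z)), B⁆‖ₑ ≤ hop 𝒮.strength F x := by
  have hH := 𝒮.isSelfAdjoint_ham S
  rw [← enorm_lie_conjExp_neg hH]
  refine (enorm_sum_lie_le _ _ _).trans ?_
  calc _ ≤ ∑ Z ∈ S.filter fun Z => x ∈ Z, 𝒮.strength Z * ∑ y ∈ Z, F y :=
        Finset.sum_le_sum fun Z _ => 𝒮.enorm_lie_le_sites (𝒮.term_mem Z) _ fun y A hA => by
          rw [enorm_lie_conjExp_neg hH]
          exact hF y A hA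
    _ = ∑ Z ∈ S.subtype fun Z => x ∈ Z, 𝒮.strength Z.1 * ∑ y ∈ Z.1, F y := by
        exact (Finset.sum_subtype_eq_sum_filter fun Z => 𝒮.strength Z * ∑ y ∈ Z, F y).symm
    _ ≤ _ := ENNReal.sum_le_tsum _

/-- The Lieb-Robinson bound for finitely many interaction terms, after `n` iterations. -/
theorem enorm_lie_conjExp_le_truncHop {K : ℝ}
    (hK : ∀ x, ∑' Z : {Z : Finset Γ // x ∈ Z}, (Z.1.card : ℝ≥0∞) * 𝒮.strength Z.1 ≤
      ENNReal.ofReal K) (S : Finset (Finset Γ)) (B : 𝔄) {c : Γ → ℝ≥0∞}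
    (hcB : ∀ y, c y ≤ 2 * ‖B‖ₑ) (hc : ∀ y, ∀ A ∈ 𝒮.loc {y}, ‖⁅A, B⁆‖ₑ ≤ ‖A‖ₑ * c y)
    (n : ℕ) (x : Γ) (A : 𝔄) (hA : A ∈ 𝒮.loc {x}) (t : ℝ) :
    ‖⁅conjExp (𝒮.ham S) t A, B⁆‖ₑ ≤ ‖A‖ₑ * ∑ k ∈ Finset.range (n + 1),
      ENNReal.ofReal ((2 * |t|) ^ k / k.factorial) *
        truncHop 𝒮.strength (ENNReal.ofReal K) (2 * ‖B‖ₑ) c n k x := by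
  have hH := 𝒮.isSelfAdjoint_ham S
  induction n generalizing x A t with
  | zero =>
    refine (enorm_lie_le _ _).trans (le_of_eq ?_)
    rw [enorm_conjExp hH]
    simp [truncHop]
    ring
  | succ n ih =>
    have hfin : ∀ k, truncHop 𝒮.strength (ENNReal.ofReal K) (2 * ‖B‖ₑ) c (n + 1) k x ≠ ⊤ :=
      fun k => ne_top_of_le_ne_top (by finiteness) (truncHop_le hK hcB (n + 1) k x)
    -- the bound for `n`, inserted into the derivative, gives the derivative of the bound for `n + 1`
    have hb : ∀ s : ℝ, 2 * ‖A‖ * ‖⁅conjExp (𝒮.ham S) s (𝒮.ham S -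
        𝒮.ham (S.filter fun Z => x ∉ Z)), B⁆‖ ≤ 2 * ‖A‖ * ∑ k ∈ Finset.range (n + 1),
          (2 * |s|) ^ k / k.factorial *
          (truncHop 𝒮.strength (ENNReal.ofReal K) (2 * ‖B‖ₑ) c (n + 1) (k + 1) x).toReal := by
      intro s
      rw [ham_sub_ham_filter, ← ENNReal.ofReal_le_ofReal_iff (by positivity),
        ENNReal.ofReal_mul (by positivity), ofReal_norm,
        ofReal_mul_sum_pow_div_factorial (by positivity) (by positivity) fun k => hfin (k + 1)]
      gcongr
      refine (𝒮.enorm_lie_conjExp_ham_filter_le S x s B fun y A hA => ih y A hA s).trans ?_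
      rw [hop_sum_mul]
      gcongr with k
      exact hop_truncHop_le hK n k x
    have h0 : ‖⁅A, B⁆‖ ≤ ‖A‖ * ∑ k ∈ Finset.range (n + 1 + 1), (2 * 0) ^ k / k.factorial *
        (truncHop 𝒮.strength (ENNReal.ofReal K) (2 * ‖B‖ₑ) c (n + 1) k x).toReal := by
      rw [← ENNReal.ofReal_le_ofReal_iff (by positivity), ofReal_norm,
        ofReal_mul_sum_pow_div_factorial (by positivity) (by norm_num) hfin, ofReal_norm]
      refine (hc x A hA).trans ?_
      gcongr
      refine le_trans ?_ (Finset.single_le_sum (fun _ _ => zero_le)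
        (Finset.mem_range.2 (Nat.succ_pos (n + 1))))
      simp [truncHop]
    have key := norm_lie_conjExp_le hH (𝒮.isSelfAdjoint_ham _) (𝒮.commute_ham_filter S hA) B
      (fun s => hasDerivAt_sum_pow_div_factorial ‖A‖ (fun k =>
        (truncHop 𝒮.strength (ENNReal.ofReal K) (2 * ‖B‖ₑ) c (n + 1) k x).toReal) (n + 1) s)
      h0 (t := t) fun s _ => hb s
    rw [← ofReal_norm]
    refine (ENNReal.ofReal_le_ofReal key).trans (le_of_eq ?_)
    rw [ofReal_mul_sum_pow_div_factorial (by positivity) (by positivity) hfin, ofReal_norm]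

/-- The Lieb-Robinson bound for finitely many interaction terms, in terms of propagation. -/
theorem enorm_lie_conjExp_le_hopExp {K : ℝ} (hK0 : 0 ≤ K)
    (hK : ∀ x, ∑' Z : {Z : Finset Γ // x ∈ Z}, (Z.1.card : ℝ≥0∞) * 𝒮.strength Z.1 ≤
      ENNReal.ofReal K) (S : Finset (Finset Γ)) (B : 𝔄) {c : Γ → ℝ≥0∞}
    (hcB : ∀ y, c y ≤ 2 * ‖B‖ₑ) (hc : ∀ y, ∀ A ∈ 𝒮.loc {y}, ‖⁅A, B⁆‖ₑ ≤ ‖A‖ₑ * c y)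
    {x : Γ} {A : 𝔄} (hA : A ∈ 𝒮.loc {x}) (t : ℝ) :
    ‖⁅conjExp (𝒮.ham S) t A, B⁆‖ₑ ≤ ‖A‖ₑ * hopExp 𝒮.strength |t| c x := by
  -- the crude last term of the bound after `n` iterations tends to zero
  have hlim : Filter.Tendsto (fun n : ℕ => ‖A‖ₑ * (hopExp 𝒮.strength |t| c x +
      ENNReal.ofReal ((2 * |t| * K) ^ n / n.factorial) * (2 * ‖B‖ₑ))) Filter.atTop
      (𝓝 (‖A‖ₑ * (hopExp 𝒮.strength |t| c x + 0 * (2 * ‖B‖ₑ)))) := by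
    refine ENNReal.Tendsto.const_mul ?_ (Or.inr enorm_ne_top)
    refine tendsto_const_nhds.add (ENNReal.Tendsto.mul_const ?_ (Or.inr (by finiteness)))
    have h := ENNReal.tendsto_ofReal
      (FloorSemiring.tendsto_pow_div_factorial_atTop (2 * |t| * K))
    rwa [ENNReal.ofReal_zero] at h
  rw [zero_mul, add_zero] at hlim
  refine ge_of_tendsto' hlim fun n => ?_
  refine (𝒮.enorm_lie_conjExp_le_truncHop hK S B hcB hc n x A hA t).trans ?_
  gcongr
  rw [Finset.sum_range_succ]
  refine add_le_add ?_ (le_of_eq ?_)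
  · refine le_trans (Finset.sum_le_sum fun k hk => ?_) (ENNReal.sum_le_tsum (Finset.range n))
    rw [truncHop, if_pos (Finset.mem_range.1 hk)]
  · rw [truncHop, if_neg (lt_irrefl n), ← mul_assoc, ← ENNReal.ofReal_pow hK0,
      ← ENNReal.ofReal_mul (by positivity), mul_pow _ K]
    congr 2
    ring

end LatticeSystem

end Lattice

/-! ### The thermodynamic limit of the dynamics -/

namespace LatticeSystem

variable {Γ : Type*} [DecidableEq Γ] {𝔄 : Type*} [NormedRing 𝔄] [StarRing 𝔄] {N : ℕ}
  (𝒮 : LatticeSystem Γ 𝔄 N)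

theorem ham_sub_ham {S S' : Finset (Finset Γ)} (h : S ⊆ S') :
    𝒮.ham S' - 𝒮.ham S = 𝒮.ham (S' \ S) :=
  (sub_eq_iff_eq_add.2 (Finset.sum_sdiff h).symm)

/-- A bound on the commutators of the interaction term of `Z` with the observables of single
sites, relative to the norms of these observables. -/
def termSource (Z : Finset Γ) (y : Γ) : ℝ≥0∞ := if y ∈ Z then 2 * ‖𝒮.term Z‖ₑ else 0

theorem termSource_le (Z : Finset Γ) (y : Γ) : 𝒮.termSource Z y ≤ 2 * ‖𝒮.term Z‖ₑ := by
  rw [termSource]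
  split_ifs
  exacts [le_rfl, zero_le]

theorem enorm_lie_term_le (Z : Finset Γ) (y : Γ) (A : 𝔄) (hA : A ∈ 𝒮.loc {y}) :
    ‖⁅A, 𝒮.term Z⁆‖ₑ ≤ ‖A‖ₑ * 𝒮.termSource Z y := by
  rw [termSource]
  split_ifs with h
  · exact (enorm_lie_le _ _).trans (le_of_eq (by ring))
  · rw [enorm_lie_of_commute
      (𝒮.commute_of_disjoint (Finset.disjoint_singleton_left.2 h) hA (𝒮.term_mem Z))]
    exact zero_le

theorem tsum_termSource_le {κ : ℝ≥0∞}
    (hK : ∀ x, ∑' Z : {Z : Finset Γ // x ∈ Z}, (Z.1.card : ℝ≥0∞) * 𝒮.strength Z.1 ≤ κ) (y : Γ) :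
    ∑' Z, 𝒮.termSource Z y ≤ 2 * κ := by
  have e : (fun Z => 𝒮.termSource Z y) =
      Set.indicator {Z : Finset Γ | y ∈ Z} fun Z => 2 * ‖𝒮.term Z‖ₑ := by
    funext Z
    simp [termSource, Set.indicator_apply]
  rw [e, ← tsum_subtype, ENNReal.tsum_mul_left]
  gcongr
  refine le_trans (ENNReal.tsum_le_tsum fun Z => ?_) (hK y)
  have h1 : (1 : ℝ≥0∞) ≤ (Z.1.card : ℝ≥0∞) := by
    exact_mod_cast Finset.card_pos.2 ⟨y, Z.2⟩
  have h2 : (1 : ℝ≥0∞) ≤ (N : ℝ≥0∞) ^ (2 * Z.1.card) :=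
    one_le_pow₀ (by exact_mod_cast 𝒮.dim_pos y)
  calc ‖𝒮.term Z.1‖ₑ = 1 * (‖𝒮.term Z.1‖ₑ * 1) := by rw [one_mul, mul_one]
    _ ≤ _ := mul_le_mul' h1 (mul_le_mul' le_rfl h2)

variable [NormedAlgebra ℂ 𝔄]

theorem limit_zero {φ : ℝ → 𝔄 → 𝔄}
    (hφ : ∀ t A, Filter.Tendsto (fun Λ : Finset Γ => conjExp (𝒮.ham Λ.powerset) t A)
      Filter.atTop (𝓝 (φ t A)))
    (A : 𝔄) : φ 0 A = A := by
  refine tendsto_nhds_unique (hφ 0 A) ?_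
  simp only [conjExp_zero_time]
  exact tendsto_const_nhds

theorem limit_sub {φ : ℝ → 𝔄 → 𝔄}
    (hφ : ∀ t A, Filter.Tendsto (fun Λ : Finset Γ => conjExp (𝒮.ham Λ.powerset) t A)
      Filter.atTop (𝓝 (φ t A)))
    (t : ℝ) (A B : 𝔄) : φ t (A - B) = φ t A - φ t B := by
  refine tendsto_nhds_unique (hφ t (A - B)) ?_
  simp only [conjExp_sub_right]
  exact (hφ t A).sub (hφ t B)

variable [CompleteSpace 𝔄] [CStarRing 𝔄] [StarModule ℂ 𝔄]

/-- The commutators of the interaction terms with an evolved local observable are summable,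
uniformly in the volume and for bounded times.  This is where the Lieb-Robinson bound enters the
construction of the dynamics. -/
theorem exists_summable_bound_lie {K : ℝ} (hK0 : 0 ≤ K)
    (hK : ∀ x, ∑' Z : {Z : Finset Γ // x ∈ Z}, (Z.1.card : ℝ≥0∞) * 𝒮.strength Z.1 ≤
      ENNReal.ofReal K) {X : Finset Γ} {A : 𝔄} (hA : A ∈ 𝒮.loc X) (T : ℝ) :
    ∃ b : Finset Γ → ℝ, Summable b ∧ ∀ S s, |s| ≤ T → ∀ Z,
      ‖⁅𝒮.term Z, conjExp (𝒮.ham S) s A⁆‖ ≤ b Z := by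
  rcases lt_or_ge T 0 with hT | hT
  · exact ⟨0, summable_zero, fun S s hs => absurd (hs.trans_lt hT) (abs_nonneg s).not_gt⟩
  let β : Finset Γ → ℝ≥0∞ := fun Z => ‖A‖ₑ * (N : ℝ≥0∞) ^ (2 * X.card) *
    ∑ x ∈ X, hopExp 𝒮.strength T (𝒮.termSource Z) x
  have hβ : ∑' Z, β Z ≠ ⊤ := by
    simp only [β]
    rw [ENNReal.tsum_mul_left, Summable.tsum_finsetSum fun _ _ => ENNReal.summable]
    refine ENNReal.mul_ne_top (by finiteness) (ENNReal.sum_ne_top.2 fun x _ => ?_)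
    rw [← hopExp_tsum]
    refine ne_top_of_le_ne_top ?_ ((hopExp_mono (𝒮.tsum_termSource_le hK) T x).trans
      (hopExp_const_le hK0 hK _ hT x))
    finiteness
  refine ⟨fun Z => (β Z).toReal, ENNReal.summable_toReal hβ, fun S s hs Z => ?_⟩
  have hH := 𝒮.isSelfAdjoint_ham S
  have h : ‖⁅𝒮.term Z, conjExp (𝒮.ham S) s A⁆‖ₑ ≤ β Z := by
    rw [enorm_lie_comm, ← enorm_lie_conjExp_neg hH]
    refine (𝒮.enorm_lie_le_sites hA _ fun y A' hA' => ?_).trans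
      (mul_le_mul' le_rfl (Finset.sum_le_sum fun x _ =>
        hopExp_mono_time (abs_nonneg s) hs (𝒮.termSource Z) x))
    rw [enorm_lie_conjExp_neg hH]
    exact 𝒮.enorm_lie_conjExp_le_hopExp hK0 hK S _ (𝒮.termSource_le Z)
      (𝒮.enorm_lie_term_le Z) hA' s
  rw [← toReal_enorm]
  exact ENNReal.toReal_mono (ENNReal.ne_top_of_tsum_ne_top hβ Z) h

theorem cauchySeq_conjExp_of_mem_loc {K : ℝ} (hK0 : 0 ≤ K)
    (hK : ∀ x, ∑' Z : {Z : Finset Γ // x ∈ Z}, (Z.1.card : ℝ≥0∞) * 𝒮.strength Z.1 ≤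
      ENNReal.ofReal K) {X : Finset Γ} {A : 𝔄} (hA : A ∈ 𝒮.loc X) (t : ℝ) :
    CauchySeq fun Λ : Finset Γ => conjExp (𝒮.ham Λ.powerset) t A := by
  obtain ⟨b, hb, hbound⟩ := 𝒮.exists_summable_bound_lie hK0 hK hA |t|
  rw [Metric.cauchySeq_iff']
  intro ε hε
  obtain ⟨S₀, hS₀⟩ := summable_iff_vanishing_norm.1 hb (ε / (|t| + 1)) (by positivity)
  -- a volume that contains all the sets of `S₀`
  refine ⟨S₀.sup id, fun Λ hΛ => ?_⟩
  have hdisj : Disjoint (Λ.powerset \ (S₀.sup id).powerset) S₀ := by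
    refine Finset.disjoint_right.2 fun Z hZ hZ' => (Finset.mem_sdiff.1 hZ').2 ?_
    exact Finset.mem_powerset.2 (Finset.le_sup (f := id) hZ)
  have h := norm_conjExp_sub_conjExp_le (H := 𝒮.ham (S₀.sup id).powerset)
    (𝒮.isSelfAdjoint_ham Λ.powerset) A (t := t) (M := ε / (|t| + 1)) fun s hs => by
      rw [𝒮.ham_sub_ham (Finset.powerset_mono.2 hΛ), ham, sum_lie_eq]
      refine (norm_sum_le_of_le _ fun Z _ => hbound _ s hs Z).trans ?_
      exact (le_abs_self _).trans (hS₀ _ hdisj).le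
  rw [dist_comm, dist_eq_norm]
  refine h.trans_lt ?_
  rw [div_mul_eq_mul_div, div_lt_iff₀ (by positivity)]
  linarith

/-- The local dynamics converge on all observables. -/
theorem exists_tendsto_conjExp {K : ℝ} (hK0 : 0 ≤ K)
    (hK : ∀ x, ∑' Z : {Z : Finset Γ // x ∈ Z}, (Z.1.card : ℝ≥0∞) * 𝒮.strength Z.1 ≤
      ENNReal.ofReal K) (t : ℝ) (A : 𝔄) :
    ∃ A' : 𝔄, Filter.Tendsto (fun Λ : Finset Γ => conjExp (𝒮.ham Λ.powerset) t A)
      Filter.atTop (𝓝 A') := by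
  refine cauchySeq_tendsto_of_complete (Metric.cauchySeq_iff'.2 fun ε hε => ?_)
  obtain ⟨A₁, ⟨X, hX⟩, hA₁⟩ := 𝒮.dense_loc.exists_dist_lt A (ε := ε / 3) (by positivity)
  obtain ⟨Λ₀, hΛ₀⟩ := Metric.cauchySeq_iff'.1 (𝒮.cauchySeq_conjExp_of_mem_loc hK0 hK hX t)
    (ε / 3) (by positivity)
  have e : ∀ Λ : Finset Γ, dist (conjExp (𝒮.ham Λ.powerset) t A)
      (conjExp (𝒮.ham Λ.powerset) t A₁) = dist A A₁ := fun Λ => by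
    rw [dist_eq_norm, ← conjExp_sub_right, norm_conjExp (𝒮.isSelfAdjoint_ham _), dist_eq_norm]
  refine ⟨Λ₀, fun Λ hΛ => ?_⟩
  have h1 := e Λ
  have h2 := e Λ₀
  have h3 := hΛ₀ Λ hΛ
  rw [dist_comm] at h2
  have h4 := dist_triangle4 (conjExp (𝒮.ham Λ.powerset) t A) (conjExp (𝒮.ham Λ.powerset) t A₁)
    (conjExp (𝒮.ham Λ₀.powerset) t A₁) (conjExp (𝒮.ham Λ₀.powerset) t A)
  linarith

/-- On local observables the derivations `i[H_Λ, ·]` converge and are bounded uniformly in the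
volume. -/
theorem exists_tendsto_lie_ham {K : ℝ} (hK0 : 0 ≤ K)
    (hK : ∀ x, ∑' Z : {Z : Finset Γ // x ∈ Z}, (Z.1.card : ℝ≥0∞) * 𝒮.strength Z.1 ≤
      ENNReal.ofReal K) {X : Finset Γ} {A : 𝔄} (hA : A ∈ 𝒮.loc X) :
    (∃ D : 𝔄, Filter.Tendsto (fun Λ : Finset Γ => Complex.I • ⁅𝒮.ham Λ.powerset, A⁆)
      Filter.atTop (𝓝 D)) ∧ ∃ M : ℝ, ∀ S, ‖⁅𝒮.ham S, A⁆‖ ≤ M := by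
  obtain ⟨b, hb, hbound⟩ := 𝒮.exists_summable_bound_lie hK0 hK hA 0
  have hb' : ∀ Z, ‖⁅𝒮.term Z, A⁆‖ ≤ b Z := fun Z => by
    simpa only [conjExp_zero_time] using hbound ∅ 0 (by simp) Z
  have hs : Summable fun Z => ⁅𝒮.term Z, A⁆ := Summable.of_norm_bounded hb hb'
  refine ⟨⟨_, (hs.hasSum.comp Filter.tendsto_finset_powerset_atTop_atTop).const_smul
    Complex.I |>.congr fun Λ => ?_⟩, ∑' Z, b Z, fun S => ?_⟩
  · rw [ham, sum_lie_eq]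
    rfl
  · rw [ham, sum_lie_eq]
    refine (norm_sum_le_of_le _ fun Z _ => hb' Z).trans (hb.sum_le_tsum S fun Z _ => ?_)
    exact (norm_nonneg _).trans (hb' Z)

/-- The dynamics are strongly continuous at time zero, uniformly in the volume. -/
theorem exists_forall_norm_conjExp_sub_self_le {K : ℝ} (hK0 : 0 ≤ K)
    (hK : ∀ x, ∑' Z : {Z : Finset Γ // x ∈ Z}, (Z.1.card : ℝ≥0∞) * 𝒮.strength Z.1 ≤
      ENNReal.ofReal K) (A : 𝔄) {ε : ℝ} (hε : 0 < ε) :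
    ∃ η > 0, ∀ S s, |s| ≤ η → ‖conjExp (𝒮.ham S) s A - A‖ ≤ ε := by
  obtain ⟨A₁, ⟨X, hX⟩, hA₁⟩ := 𝒮.dense_loc.exists_dist_lt A (ε := ε / 3) (by positivity)
  obtain ⟨-, M, hM⟩ := 𝒮.exists_tendsto_lie_ham hK0 hK hX
  have hM0 : 0 ≤ M := (norm_nonneg _).trans (hM ∅)
  refine ⟨ε / 3 / (M + 1), by positivity, fun S s hs => ?_⟩
  have hH := 𝒮.isSelfAdjoint_ham S
  have h1 : ‖conjExp (𝒮.ham S) s A₁ - A₁‖ ≤ ε / 3 := by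
    refine (norm_conjExp_sub_self_le hH A₁ s).trans ?_
    calc ‖⁅𝒮.ham S, A₁⁆‖ * |s| ≤ (M + 1) * (ε / 3 / (M + 1)) := by
          gcongr
          linarith [hM S]
      _ = ε / 3 := by field_simp
  have h2 : ‖conjExp (𝒮.ham S) s (A - A₁)‖ = ‖A - A₁‖ := norm_conjExp hH s _
  rw [dist_eq_norm] at hA₁
  have e : conjExp (𝒮.ham S) s A - A =
      conjExp (𝒮.ham S) s (A - A₁) + (conjExp (𝒮.ham S) s A₁ - A₁) - (A - A₁) := by
    rw [conjExp_sub_right]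
    abel
  rw [e]
  have h3 := norm_sub_le (conjExp (𝒮.ham S) s (A - A₁) + (conjExp (𝒮.ham S) s A₁ - A₁)) (A - A₁)
  have h4 := norm_add_le (conjExp (𝒮.ham S) s (A - A₁)) (conjExp (𝒮.ham S) s A₁ - A₁)
  linarith

/-! ### Properties of the limit dynamics -/

theorem norm_limit {φ : ℝ → 𝔄 → 𝔄}
    (hφ : ∀ t A, Filter.Tendsto (fun Λ : Finset Γ => conjExp (𝒮.ham Λ.powerset) t A)
      Filter.atTop (𝓝 (φ t A)))
    (t : ℝ) (A : 𝔄) : ‖φ t A‖ = ‖A‖ := by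
  refine tendsto_nhds_unique (hφ t A).norm ?_
  simp only [norm_conjExp (𝒮.isSelfAdjoint_ham _)]
  exact tendsto_const_nhds

theorem limit_add_time {φ : ℝ → 𝔄 → 𝔄}
    (hφ : ∀ t A, Filter.Tendsto (fun Λ : Finset Γ => conjExp (𝒮.ham Λ.powerset) t A)
      Filter.atTop (𝓝 (φ t A)))
    (s t : ℝ) (A : 𝔄) : φ (s + t) A = φ s (φ t A) := by
  refine tendsto_nhds_unique (hφ (s + t) A) ?_
  have h1 : Filter.Tendsto (fun Λ : Finset Γ =>
      conjExp (𝒮.ham Λ.powerset) s (conjExp (𝒮.ham Λ.powerset) t A - φ t A))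
      Filter.atTop (𝓝 0) := by
    rw [tendsto_zero_iff_norm_tendsto_zero]
    simp only [norm_conjExp (𝒮.isSelfAdjoint_ham _)]
    exact tendsto_iff_norm_sub_tendsto_zero.1 (hφ t A)
  have h2 := h1.add (hφ s (φ t A))
  simp only [conjExp_sub_right, sub_add_cancel, conjExp_conjExp, zero_add] at h2
  exact h2

/-- The limit dynamics at a fixed time, as an automorphism. -/
def limitEquiv {φ : ℝ → 𝔄 → 𝔄}
    (hφ : ∀ t A, Filter.Tendsto (fun Λ : Finset Γ => conjExp (𝒮.ham Λ.powerset) t A)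
      Filter.atTop (𝓝 (φ t A)))
    (t : ℝ) : 𝔄 ≃⋆ₐ[ℂ] 𝔄 where
  toFun := φ t
  invFun := φ (-t)
  left_inv A := by rw [← 𝒮.limit_add_time hφ, neg_add_cancel, 𝒮.limit_zero hφ]
  right_inv A := by rw [← 𝒮.limit_add_time hφ, add_neg_cancel, 𝒮.limit_zero hφ]
  map_mul' A B := by
    refine tendsto_nhds_unique (hφ t (A * B)) ?_
    simp only [conjExp_mul]
    exact (hφ t A).mul (hφ t B)
  map_add' A B := by
    refine tendsto_nhds_unique (hφ t (A + B)) ?_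
    simp only [conjExp_add_right]
    exact (hφ t A).add (hφ t B)
  map_star' A := by
    refine tendsto_nhds_unique (hφ t (star A)) ?_
    simp only [← star_conjExp (𝒮.isSelfAdjoint_ham _)]
    exact (hφ t A).star
  map_smul' c A := by
    refine tendsto_nhds_unique (hφ t (c • A)) ?_
    simp only [conjExp_smul]
    exact (hφ t A).const_smul c

theorem continuous_limit {φ : ℝ → 𝔄 → 𝔄}
    (hφ : ∀ t A, Filter.Tendsto (fun Λ : Finset Γ => conjExp (𝒮.ham Λ.powerset) t A)
      Filter.atTop (𝓝 (φ t A)))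
    {K : ℝ} (hK0 : 0 ≤ K)
    (hK : ∀ x, ∑' Z : {Z : Finset Γ // x ∈ Z}, (Z.1.card : ℝ≥0∞) * 𝒮.strength Z.1 ≤
      ENNReal.ofReal K) (A : 𝔄) : Continuous fun t => φ t A := by
  refine Metric.continuous_iff.2 fun t ε hε => ?_
  obtain ⟨η, hη, h⟩ := 𝒮.exists_forall_norm_conjExp_sub_self_le hK0 hK A (half_pos hε)
  refine ⟨η, hη, fun s hs => ?_⟩
  have e : φ s A - φ t A = φ t (φ (s - t) A - A) := by
    rw [𝒮.limit_sub hφ, ← 𝒮.limit_add_time hφ, add_sub_cancel]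
  rw [dist_eq_norm, e, 𝒮.norm_limit hφ]
  refine lt_of_le_of_lt ?_ (half_lt_self hε)
  exact le_of_tendsto' ((hφ (s - t) A).sub_const A).norm fun Λ => h _ _ hs.le

theorem hasDerivAt_limit {φ : ℝ → 𝔄 → 𝔄}
    (hφ : ∀ t A, Filter.Tendsto (fun Λ : Finset Γ => conjExp (𝒮.ham Λ.powerset) t A)
      Filter.atTop (𝓝 (φ t A)))
    {K : ℝ} (hK0 : 0 ≤ K)
    (hK : ∀ x, ∑' Z : {Z : Finset Γ // x ∈ Z}, (Z.1.card : ℝ≥0∞) * 𝒮.strength Z.1 ≤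
      ENNReal.ofReal K) {A D : 𝔄}
    (hD : Filter.Tendsto (fun Λ : Finset Γ => Complex.I • ⁅𝒮.ham Λ.powerset, A⁆)
      Filter.atTop (𝓝 D)) : HasDerivAt (fun t => φ t A) D 0 := by
  rw [hasDerivAt_iff_isLittleO_nhds_zero, Asymptotics.isLittleO_iff]
  intro ε hε
  obtain ⟨η, hη, h⟩ := 𝒮.exists_forall_norm_conjExp_sub_self_le hK0 hK D hε
  filter_upwards [Metric.closedBall_mem_nhds (0 : ℝ) hη] with t ht
  rw [mem_closedBall_zero_iff, Real.norm_eq_abs] at ht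
  simp only [zero_add, 𝒮.limit_zero hφ, Real.norm_eq_abs]
  -- the volume is sent to infinity in the first-order expansion of the local dynamics
  have h1 := (((hφ t A).sub_const A).sub (hD.const_smul t)).norm
  have h2 : Filter.Tendsto (fun Λ : Finset Γ =>
      (ε + 2 * ‖Complex.I • ⁅𝒮.ham Λ.powerset, A⁆ - D‖) * |t|) Filter.atTop
      (𝓝 ((ε + 2 * 0) * |t|)) :=
    (((tendsto_iff_norm_sub_tendsto_zero.1 hD).const_mul 2).const_add ε).mul_const |t|
  rw [mul_zero, add_zero] at h2
  refine le_of_tendsto_of_tendsto' h1 h2 fun Λ => ?_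
  refine norm_conjExp_sub_self_sub_smul_le _ A fun s hs => ?_
  set H := 𝒮.ham Λ.powerset with hHdef
  set D' := Complex.I • ⁅H, A⁆
  have hH : IsSelfAdjoint H := 𝒮.isSelfAdjoint_ham _
  have e : conjExp H s D' - D' = (conjExp H s D - D) + (conjExp H s (D' - D) - (D' - D)) := by
    rw [conjExp_sub_right]
    abel
  have h3 := norm_add_le (conjExp H s D - D) (conjExp H s (D' - D) - (D' - D))
  have h4 := norm_sub_le (conjExp H s (D' - D)) (D' - D)
  rw [norm_conjExp hH] at h4
  have h5 := h Λ.powerset s (hs.trans ht)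
  rw [e]
  linarith

end LatticeSystem

/-! ### The quantum spin system as a lattice system -/

section Concrete

variable {Γ : Type*} [DecidableEq Γ] {d : Γ → ℕ}

/-- The lattice system of an interaction in the quasi-local algebra. -/
def Interaction.toLatticeSystem (Φ : Interaction d) {N : ℕ} (hd_pos : ∀ x, 0 < d x)
    (hd_le : ∀ x, d x ≤ N) : LatticeSystem Γ (QuasiLocal d) N where
  loc X := localAlgebra d X
  dim_pos x := (hd_pos x).trans_le (hd_le x)
  commute_of_disjoint h _ _ hA hB := commute_of_disjoint h hA hB
  dense_loc := dense_local d
  enorm_lie_le_sites hA B _ hc := enorm_lie_le_of_mem_local hd_pos hd_le hA B hc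
  term := Φ.term
  term_mem := Φ.term_mem
  isSelfAdjoint_term := Φ.isSelfAdjoint_term

theorem commBound_le {α : ℝ → QuasiLocal d ≃⋆ₐ[ℂ] QuasiLocal d} {B : QuasiLocal d} {x : Γ} {t : ℝ}
    {C : ℝ≥0∞} (h : ∀ A ∈ localAlgebra d {x}, ‖⁅α t A, B⁆‖ₑ ≤ ‖A‖ₑ * C) :
    commBound α B x t ≤ C :=
  iSup₂_le fun A hA => ENNReal.div_le_of_le_mul' (h A hA)

theorem enorm_lie_le_commBound (α : ℝ → QuasiLocal d ≃⋆ₐ[ℂ] QuasiLocal d) (B : QuasiLocal d)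
    {x : Γ} (t : ℝ) {A : QuasiLocal d} (hA : A ∈ localAlgebra d {x}) :
    ‖⁅α t A, B⁆‖ₑ ≤ ‖A‖ₑ * commBound α B x t := by
  refine enorm_le_mul_of_div_le (fun h => ?_) (le_iSup₂ (f := fun (A : QuasiLocal d)
    (_ : A ∈ localAlgebra d {x}) => ‖α t A * B - B * α t A‖ₑ / ‖A‖ₑ) A hA)
  rw [h, map_zero, Ring.lie_def, zero_mul, mul_zero, sub_self]

section

variable {Φ : Interaction d} {α : ℝ → QuasiLocal d ≃⋆ₐ[ℂ] QuasiLocal d}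

theorem IsDynamics.apply_zero (h : IsDynamics Φ α) (A : QuasiLocal d) : α 0 A = A := by
  refine tendsto_nhds_unique (h.tendsto_localDynamics 0 A) ?_
  have e : ∀ Λ, Φ.localDynamics Λ 0 A = A := fun Λ => conjExp_zero_time (Φ.hamiltonian Λ) A
  simp only [e]
  exact tendsto_const_nhds

theorem IsDynamics.commBound_zero_le (h : IsDynamics Φ α) (B : QuasiLocal d) (x : Γ) :
    commBound α B x 0 ≤ 2 * ‖B‖ₑ :=
  commBound_le fun A _ => by
    rw [h.apply_zero]
    exact (enorm_lie_le A B).trans (le_of_eq (by ring))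

theorem IsDynamics.commBound_zero_eq_zero (h : IsDynamics Φ α) {X : Finset Γ} {B : QuasiLocal d}
    (hB : B ∈ localAlgebra d X) {x : Γ} (hx : x ∉ X) : commBound α B x 0 = 0 :=
  le_antisymm (commBound_le fun A hA => by
    rw [h.apply_zero,
      enorm_lie_of_commute (commute_of_disjoint (Finset.disjoint_singleton_left.2 hx) hA hB)]
    exact zero_le) zero_le

theorem IsDynamics.eq {α' : ℝ → QuasiLocal d ≃⋆ₐ[ℂ] QuasiLocal d} (h : IsDynamics Φ α)
    (h' : IsDynamics Φ α') : α = α' :=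
  funext fun t => StarAlgEquiv.ext fun A =>
    tendsto_nhds_unique (h.tendsto_localDynamics t A) (h'.tendsto_localDynamics t A)

end

section

variable [MetricSpace Γ] (Φ : Interaction d) {N : ℕ} {lam : ℝ}

theorem Interaction.tsum_strength_mul_exp_le (hd_pos : ∀ x, 0 < d x)
    (hd_le : ∀ x, d x ≤ N) (hΦ : Φ.norm N lam < ⊤) (x : Γ) :
    ∑' Z : {Z : Finset Γ // x ∈ Z},
      (Z.1.card : ℝ≥0∞) * (Φ.toLatticeSystem hd_pos hd_le).strength Z.1 *
        ENNReal.ofReal (Real.exp (lam * Metric.diam (Z.1 : Set Γ))) ≤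
      ENNReal.ofReal (Φ.norm N lam).toReal := by
  rw [ENNReal.ofReal_toReal hΦ.ne]
  refine le_trans (le_of_eq (tsum_congr fun Z => ?_)) (le_iSup (fun x : Γ =>
    ∑' Λ : {Λ : Finset Γ // x ∈ Λ}, (Λ.1.card : ℝ≥0∞) * ‖Φ.term Λ.1‖ₑ *
      (N : ℝ≥0∞) ^ (2 * Λ.1.card) *
      ENNReal.ofReal (Real.exp (lam * Metric.diam (Λ.1 : Set Γ)))) x)
  rw [mul_assoc (Z.1.card : ℝ≥0∞) ‖Φ.term Z.1‖ₑ]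
  rfl

theorem Interaction.tsum_strength_le (hd_pos : ∀ x, 0 < d x)
    (hd_le : ∀ x, d x ≤ N) (hlam : 0 ≤ lam) (hΦ : Φ.norm N lam < ⊤) (x : Γ) :
    ∑' Z : {Z : Finset Γ // x ∈ Z},
      (Z.1.card : ℝ≥0∞) * (Φ.toLatticeSystem hd_pos hd_le).strength Z.1 ≤
      ENNReal.ofReal (Φ.norm N lam).toReal := by
  refine le_trans (ENNReal.tsum_le_tsum fun Z => ?_)
    (Φ.tsum_strength_mul_exp_le hd_pos hd_le hΦ x)
  refine le_mul_of_one_le_right zero_le (ENNReal.one_le_ofReal.2 (Real.one_le_exp ?_))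
  exact mul_nonneg hlam Metric.diam_nonneg

theorem Interaction.exists_isDynamics (hd_pos : ∀ x, 0 < d x)
    (hd_le : ∀ x, d x ≤ N) (hlam : 0 ≤ lam) (hΦ : Φ.norm N lam < ⊤) :
    ∃ α : ℝ → QuasiLocal d ≃⋆ₐ[ℂ] QuasiLocal d, IsDynamics Φ α := by
  have hK := Φ.tsum_strength_le hd_pos hd_le hlam hΦ
  have hK0 : 0 ≤ (Φ.norm N lam).toReal := ENNReal.toReal_nonneg
  choose φ hφ using (Φ.toLatticeSystem hd_pos hd_le).exists_tendsto_conjExp hK0 hK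
  refine ⟨fun t => (Φ.toLatticeSystem hd_pos hd_le).limitEquiv hφ t, ?_, ?_, ?_, ?_⟩
  · exact fun s t A => (Φ.toLatticeSystem hd_pos hd_le).limit_add_time hφ s t A
  · exact fun A => (Φ.toLatticeSystem hd_pos hd_le).continuous_limit hφ hK0 hK A
  · exact hφ
  · intro X A hA
    obtain ⟨⟨D, hD⟩, -⟩ := (Φ.toLatticeSystem hd_pos hd_le).exists_tendsto_lie_ham hK0 hK hA
    exact ⟨D, hD, (Φ.toLatticeSystem hd_pos hd_le).hasDerivAt_limit hφ hK0 hK hD⟩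

variable {Φ}

/-- The Lieb-Robinson bound for an arbitrary observable `B`. -/
theorem IsDynamics.commBound_le {α : ℝ → QuasiLocal d ≃⋆ₐ[ℂ] QuasiLocal d} (h : IsDynamics Φ α)
    (hd_pos : ∀ x, 0 < d x)
    (hd_le : ∀ x, d x ≤ N)
    (hlam : 0 ≤ lam) (hΦ : Φ.norm N lam < ⊤) (x : Γ) (t : ℝ) (B : QuasiLocal d) :
    commBound α B x t ≤
      ENNReal.ofReal (Real.exp (2 * |t| * (Φ.norm N lam).toReal)) * commBound α B x 0 +
        ∑' y : {y : Γ // y ≠ x}, ENNReal.ofReal (Real.exp (-lam * dist x y.1)) *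
          ENNReal.ofReal (Real.exp (2 * |t| * (Φ.norm N lam).toReal) - 1) *
          commBound α B y.1 0 := by
  have hK0 : 0 ≤ (Φ.norm N lam).toReal := ENNReal.toReal_nonneg
  refine le_trans (SpinSystem.commBound_le fun A hA => ?_)
    (hopExp_le hK0 hlam (Φ.tsum_strength_mul_exp_le hd_pos hd_le hΦ) (abs_nonneg t)
      (fun y => commBound α B y 0) x)
  have h1 : ∀ Λ : Finset Γ, ‖⁅Φ.localDynamics Λ t A, B⁆‖ₑ ≤ ‖A‖ₑ *
      hopExp (Φ.toLatticeSystem hd_pos hd_le).strength |t| (fun y => commBound α B y 0) x :=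
    fun Λ => (Φ.toLatticeSystem hd_pos hd_le).enorm_lie_conjExp_le_hopExp hK0
      (Φ.tsum_strength_le hd_pos hd_le hlam hΦ) Λ.powerset B (h.commBound_zero_le B)
      (fun y A' hA' => by
        simpa only [h.apply_zero] using enorm_lie_le_commBound α B 0 hA') hA t
  have h2 := h.tendsto_localDynamics t A
  exact le_of_tendsto' ((h2.mul_const B).sub (h2.const_mul B)).enorm h1

/-- The Lieb-Robinson bound for a local observable `B`. -/
theorem IsDynamics.commBound_le_of_mem_local {α : ℝ → QuasiLocal d ≃⋆ₐ[ℂ] QuasiLocal d}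
    (h : IsDynamics Φ α) (hd_pos : ∀ x, 0 < d x)
    (hd_le : ∀ x, d x ≤ N)
    (hlam : 0 ≤ lam) (hΦ : Φ.norm N lam < ⊤) {x : Γ} (t : ℝ) {X : Finset Γ}
    (hx : x ∉ X) {B : QuasiLocal d} (hB : B ∈ localAlgebra d X) :
    commBound α B x t ≤
      ENNReal.ofReal (2 * X.card * ‖B‖ * Real.exp (-lam * Metric.infDist x (X : Set Γ)) *
        (Real.exp (2 * |t| * (Φ.norm N lam).toReal) - 1)) := by
  have hE : 0 ≤ Real.exp (2 * |t| * (Φ.norm N lam).toReal) - 1 :=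
    sub_nonneg.2 (Real.one_le_exp (by positivity))
  refine (h.commBound_le hd_pos hd_le hlam hΦ x t B).trans ?_
  rw [h.commBound_zero_eq_zero hB hx, mul_zero, zero_add]
  generalize hE' : Real.exp (2 * |t| * (Φ.norm N lam).toReal) - 1 = E at hE ⊢
  set e := Real.exp (-lam * Metric.infDist x (X : Set Γ)) with he
  calc _ ≤ ∑' y : Γ, ENNReal.ofReal (Real.exp (-lam * dist x y)) * ENNReal.ofReal E *
          commBound α B y 0 :=
        ENNReal.tsum_comp_le_tsum_of_injective Subtype.val_injective _
    _ = ∑ y ∈ X, ENNReal.ofReal (Real.exp (-lam * dist x y)) * ENNReal.ofReal E *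
          commBound α B y 0 :=
        tsum_eq_sum fun y hy => by rw [h.commBound_zero_eq_zero hB hy, mul_zero]
    _ ≤ ∑ _y ∈ X, ENNReal.ofReal e * ENNReal.ofReal E * (2 * ‖B‖ₑ) := by
        refine Finset.sum_le_sum fun y hy => ?_
        refine mul_le_mul' (mul_le_mul' ?_ le_rfl) (h.commBound_zero_le B y)
        refine ENNReal.ofReal_le_ofReal (Real.exp_le_exp.2 ?_)
        have := Metric.infDist_le_dist_of_mem (x := x) (Finset.mem_coe.2 hy)
        nlinarith
    _ = _ := by
        rw [Finset.sum_const, nsmul_eq_mul, ENNReal.ofReal_mul (by positivity),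
          ENNReal.ofReal_mul (by positivity), ENNReal.ofReal_mul (by positivity),
          ENNReal.ofReal_mul (by norm_num), ENNReal.ofReal_natCast, ofReal_norm,
          ENNReal.ofReal_ofNat]
        ring

end

end Concrete

end SpinSystem

end

/-- The Lieb-Robinson bound. -/
theorem mainTheorem1 {Γ : Type*} [DecidableEq Γ] [MetricSpace Γ] (d : Γ → ℕ) (N : ℕ)
    (hd_pos : ∀ x, 0 < d x) (hd_le : ∀ x, d x ≤ N) (lam : ℝ) (hlam : 0 < lam)
    (Φ : SpinSystem.Interaction d) (hΦ : Φ.norm N lam < ⊤) :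
    (∃! α : ℝ → SpinSystem.QuasiLocal d ≃⋆ₐ[ℂ] SpinSystem.QuasiLocal d,
      SpinSystem.IsDynamics Φ α) ∧
    ∀ α : ℝ → SpinSystem.QuasiLocal d ≃⋆ₐ[ℂ] SpinSystem.QuasiLocal d,
      SpinSystem.IsDynamics Φ α →
      (∀ (x : Γ) (t : ℝ) (B : SpinSystem.QuasiLocal d),
        SpinSystem.commBound α B x t ≤
          ENNReal.ofReal (Real.exp (2 * |t| * (Φ.norm N lam).toReal)) *
              SpinSystem.commBound α B x 0 +
            ∑' y : {y : Γ // y ≠ x},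
              ENNReal.ofReal (Real.exp (-lam * dist x y.1)) *
                ENNReal.ofReal (Real.exp (2 * |t| * (Φ.norm N lam).toReal) - 1) *
                SpinSystem.commBound α B y.1 0) ∧
      (∀ (x : Γ) (t : ℝ) (X : Finset Γ), x ∉ X → ∀ B ∈ SpinSystem.localAlgebra d X,
        SpinSystem.commBound α B x t ≤
          ENNReal.ofReal (2 * X.card * ‖B‖ * Real.exp (-lam * Metric.infDist x (X : Set Γ)) *
            (Real.exp (2 * |t| * (Φ.norm N lam).toReal) - 1))) := by
  obtain ⟨α, hα⟩ := Φ.exists_isDynamics hd_pos hd_le hlam.le hΦ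
  exact ⟨⟨α, hα, fun α' hα' => hα'.eq hα⟩, fun α hα =>
    ⟨fun x t B => hα.commBound_le hd_pos hd_le hlam.le hΦ x t B,
      fun x t X hx B hB => hα.commBound_le_of_mem_local hd_pos hd_le hlam.le hΦ t hx hB⟩⟩
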